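/- Let $G=(V,E)$ be a finite simple undirected graph. An articulation point of $G$ is a vertex whose removal (together with its incident edges) increases the number of connected components. The impact of an articulation point $v$ is the number of vertices that get disconnected from the largest surviving component when $v$ is removed: if $K$ is the connected component of $G$ containing $v$, and $M$ is a connected component of maximum size among those into which $K\setminus\{v\}$ splits when $v$ is removed, then $$\mathrm{impact}(v)=|K|-1-|M| .$$ It is possible to determine all articulation points of $G$ and to compute the impact of each of them in $O(|V|+|E|)$ time and space. Precisely: there are a program for the random access machine (unit cost per operation: addition, truncated subtraction, comparison, memory access, branching) and a constant $C$ such that, for every $n\ge 0$ and every graph $G$ on the vertices $0,\dots,n-1$ with $m$ edges, given by adjacency lists in arbitrary order, the program halts after at most $C(n+m+1)$ steps, uses only $C(n+m+1)$ memory cells besides a fixed number of registers, handles only integers smaller than $C(n+m+1)$ (words of $\log_2(n+m+1)+O(1)$ bits), and leaves in memory an array that marks which vertices are articulation points and an array that contains the impact of every articulation point. -/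

import Mathlib

/-! ### Articulation points and impact -/

namespace SimpleGraph

variable {V : Type*}

/-- The graph obtained from `G` by removing the vertex `v` together with its incident edges. -/
abbrev removeVertex (G : SimpleGraph V) (v : V) : SimpleGraph ({v}ᶜ : Set V) :=
  G.induce ({v}ᶜ : Set V)

/-- `v` is an articulation point of the (finite) graph `G`: its removal increases the number of
connected components. -/
def IsArticulationPoint (G : SimpleGraph V) (v : V) : Prop :=
  Nat.card G.ConnectedComponent < Nat.card (G.removeVertex v).ConnectedComponent

/-- The sizes of the connected components into which the connected component of `v` in `G` falls
apart when `v` is removed. -/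
def survivingSizes (G : SimpleGraph V) (v : V) : Set ℕ :=
  {k | ∃ C : (G.removeVertex v).ConnectedComponent,
    (∀ w ∈ C.supp, G.Reachable v (w : V)) ∧ C.supp.ncard = k}

/-- The impact of `v` in the (finite) graph `G`: among the vertices `w ≠ v` of the connected
component of `v`, the number of those outside a largest one of the components into which it falls
apart when `v` is removed. -/
noncomputable def impact (G : SimpleGraph V) (v : V) : ℕ :=
  {w : V | w ≠ v ∧ G.Reachable v w}.ncard - sSup (G.survivingSizes v)

/-- `adj` is an adjacency-list representation of `G`: `adj v` lists every neighbour of `v` exactly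
once, in an arbitrary order. -/
def IsAdjacencyList {n : ℕ} (G : SimpleGraph (Fin n)) (adj : Fin n → List (Fin n)) : Prop :=
  ∀ v, (adj v).Nodup ∧ ∀ u, u ∈ adj v ↔ G.Adj v u

end SimpleGraph

/-! ### A random access machine with structured programs and unit cost per operation -/

namespace RAM

/-- The store of the machine: registers (a program mentions only finitely many of them) and a
random access memory. -/
structure State where
  /-- contents of the registers -/
  reg : ℕ → ℕ
  /-- contents of the memory cells -/
  mem : ℕ → ℕ

/-- Expressions: constants, registers, memory reads at a computed address, sums, truncated
differences, and the comparisons `<` and `=` (with value `1` or `0`). -/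
inductive Expr where
  | lit (k : ℕ)
  | reg (x : ℕ)
  | read (a : Expr)
  | add (e f : Expr)
  | sub (e f : Expr)
  | lt (e f : Expr)
  | eq (e f : Expr)

namespace Expr

/-- The value of an expression. -/
def eval (s : State) : Expr → ℕ
  | lit k => k
  | reg x => s.reg x
  | read a => s.mem (a.eval s)
  | add e f => e.eval s + f.eval s
  | sub e f => e.eval s - f.eval s
  | lt e f => if e.eval s < f.eval s then 1 else 0
  | eq e f => if e.eval s = f.eval s then 1 else 0

/-- The cost of evaluating an expression: one step for every constant, register access, memory
access and operation in it. -/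
def cost : Expr → ℕ
  | lit _ => 1
  | reg _ => 1
  | read a => a.cost + 1
  | add e f => e.cost + f.cost + 1
  | sub e f => e.cost + f.cost + 1
  | lt e f => e.cost + f.cost + 1
  | eq e f => e.cost + f.cost + 1

/-- The evaluation stays within a machine that has the memory cells `0, …, B - 1` and whose words
hold the numbers `0, …, B - 1`: every intermediate value, in particular every address, is below
`B`. -/
def Fits (B : ℕ) (s : State) : Expr → Prop
  | lit k => k < B
  | reg x => s.reg x < B
  | read a => a.Fits B s ∧ s.mem (a.eval s) < B
  | add e f => e.Fits B s ∧ f.Fits B s ∧ e.eval s + f.eval s < B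
  | sub e f => e.Fits B s ∧ f.Fits B s
  | lt e f => e.Fits B s ∧ f.Fits B s ∧ 1 < B
  | eq e f => e.Fits B s ∧ f.Fits B s ∧ 1 < B

end Expr

/-- Programs. A condition counts as true if its value is not `0`. -/
inductive Prog where
  | skip
  | assign (x : ℕ) (e : Expr)
  | store (a e : Expr)
  | seq (p q : Prog)
  | ite (c : Expr) (p q : Prog)
  | loop (c : Expr) (p : Prog)

/-- `Exec B p s t s'`: on a machine with `B` memory cells whose words hold numbers below `B`, the
program `p`, started in the state `s`, halts in the state `s'` after exactly `t` steps, without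
addressing a cell outside the memory and without an overflow. -/
inductive Exec (B : ℕ) : Prog → State → ℕ → State → Prop
  | skip (s : State) : Exec B Prog.skip s 1 s
  | assign (x : ℕ) (e : Expr) (s : State) (he : e.Fits B s) :
      Exec B (Prog.assign x e) s (e.cost + 1) { s with reg := Function.update s.reg x (e.eval s) }
  | store (a e : Expr) (s : State) (ha : a.Fits B s) (he : e.Fits B s) :
      Exec B (Prog.store a e) s (a.cost + e.cost + 1)
        { s with mem := Function.update s.mem (a.eval s) (e.eval s) }
  | seq {p q : Prog} {s s' s'' : State} {t t' : ℕ} (hp : Exec B p s t s')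
      (hq : Exec B q s' t' s'') : Exec B (Prog.seq p q) s (t + t') s''
  | ite_true {c : Expr} {p q : Prog} {s s' : State} {t : ℕ} (hc : c.Fits B s)
      (h : c.eval s ≠ 0) (hp : Exec B p s t s') : Exec B (Prog.ite c p q) s (c.cost + 1 + t) s'
  | ite_false {c : Expr} {p q : Prog} {s s' : State} {t : ℕ} (hc : c.Fits B s)
      (h : c.eval s = 0) (hq : Exec B q s t s') : Exec B (Prog.ite c p q) s (c.cost + 1 + t) s'
  | loop_true {c : Expr} {p : Prog} {s s' s'' : State} {t t' : ℕ} (hc : c.Fits B s)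
      (h : c.eval s ≠ 0) (hp : Exec B p s t s') (hl : Exec B (Prog.loop c p) s' t' s'') :
      Exec B (Prog.loop c p) s (c.cost + 1 + t + t') s''
  | loop_false {c : Expr} {p : Prog} {s : State} (hc : c.Fits B s) (h : c.eval s = 0) :
      Exec B (Prog.loop c p) s (c.cost + 1) s

/-- The address of the first entry of the `k`-th adjacency list in `encode adj`; for `k = n`, the
address just after the last list. -/
def listStart {n : ℕ} (adj : Fin n → List (Fin n)) (k : ℕ) : ℕ :=
  n + 2 + (((List.ofFn adj).take k).map List.length).sum

/-- The input: the number `n` of vertices, the `n + 1` addresses at which the adjacency lists start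
and the last one ends, and the adjacency lists one after the other. -/
def encode {n : ℕ} (adj : Fin n → List (Fin n)) : List ℕ :=
  n :: ((List.range (n + 1)).map (listStart adj) ++ (List.ofFn adj).flatten.map Fin.val)

/-- The initial state: the input stands at the beginning of the memory, everything else is `0`. -/
def init {n : ℕ} (adj : Fin n → List (Fin n)) : State where
  reg _ := 0
  mem a := (encode adj).getD a 0

end RAM

/-! Join an artificial root `n` to all vertices and run a depth-first search from it. The result is
a spanning forest whose trees hang from `n`, and every edge of `G` joins a vertex to one of its
ancestors (`Invariant.discover`, `Invariant.forest`, `Forest.adj_anc`). Hence, when `v` is removed,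
the subtree below a child `c` is a component of its own exactly if no edge leads from it to a proper
ancestor of `v`; call such a `c` a cut child. Whatever else remains of the component `K` of `v` is
connected through the root of its tree (`Forest.rest_connected`). The surviving components therefore
have the sizes of the cut subtrees, and, if it is not `0`, the size `|K| - 1 - (their sum)` of the
rest. So the impact is `|K| - 1` minus the maximum of these numbers (`Forest.sSup_survivingSizes`).
The root of a tree needs no special treatment: the lists of the vertices do not contain `n`, so all
its children are cut children and the rest is empty. Articulation points are recognized by positive
impact.

A child `c` of `v` is a cut child iff its low point, the least number of a neighbour of its subtree,
is not below the number of `v`. Low points, subtree sizes, sums and maxima are accumulated from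
children to parents in decreasing order of the search numbers (`Accumulated.step`); component sizes
travel from parents to children in increasing order. The search is linear because each step advances
one list pointer, and both passes handle each vertex once.

For the machine, loop-free code over named arrays is compiled to code over one memory with
interleaved arrays (`ArrayProg.exec_compile`). One run of such code multiplies the largest stored
number by at most a constant, and the loop invariants bring the bound back to a fixed `W = O(n + m +
1)` after every pass (`Achieves.loop`), so all words stay linear. -/

/-! ### Programs with arrays and their compilation to the random access machine -/

namespace RAM

/-- All registers and memory cells hold numbers below `W`. -/
def State.Below (W : ℕ) (s : State) : Prop :=
  (∀ x, s.reg x < W) ∧ ∀ a, s.mem a < W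

/-- A factor by which the value of an expression may exceed the contents of the store. -/
def Expr.growth : Expr → ℕ
  | lit k => k + 1
  | reg _ => 1
  | read a => a.growth
  | add e f => e.growth + f.growth
  | sub e f => e.growth + f.growth
  | lt e f => e.growth + f.growth
  | eq e f => e.growth + f.growth

theorem Expr.one_le_growth (e : Expr) : 1 ≤ e.growth := by
  induction e <;> simp only [growth] <;> omega

theorem State.Below.pos {W : ℕ} {s : State} (h : s.Below W) : 0 < W :=
  (Nat.zero_le _).trans_lt (h.1 0)

theorem State.Below.mono {W W' : ℕ} {s : State} (h : s.Below W) (hW : W ≤ W') : s.Below W' :=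
  ⟨fun x => (h.1 x).trans_le hW, fun a => (h.2 a).trans_le hW⟩

theorem Expr.eval_lt_growth {W : ℕ} {s : State} (h : s.Below W) (e : Expr) :
    e.eval s < e.growth * W := by
  have hW := h.pos
  have one (e f : Expr) : 1 < (e.growth + f.growth) * W :=
    calc 1 < e.growth + f.growth := by
            have := e.one_le_growth
            have := f.one_le_growth
            omega
      _ ≤ _ := Nat.le_mul_of_pos_right _ hW
  induction e with
  | lit k => exact (Nat.lt_succ_self k).trans_le (Nat.le_mul_of_pos_right _ hW)
  | reg x => simpa [growth, eval] using h.1 x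
  | read a _ => exact (h.2 _).trans_le (Nat.le_mul_of_pos_left _ a.one_le_growth)
  | add e f he hf => simp only [growth, eval, add_mul]; omega
  | sub e f he hf => simp only [growth, eval, add_mul]; omega
  | lt e f _ _ => have := one e f; simp only [growth, eval]; split_ifs <;> omega
  | eq e f _ _ => have := one e f; simp only [growth, eval]; split_ifs <;> omega

/-- The growth of an expression dominates that of its subexpressions, addresses included, so one
inequality rules out overflow at every intermediate value. -/
theorem Expr.fits_of_growth {B W : ℕ} {s : State} (h : s.Below W) (e : Expr)
    (hB : e.growth * W ≤ B) : e.Fits B s := by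
  have hW := h.pos
  have one (e f : Expr) : 1 < (e.growth + f.growth) * W :=
    calc 1 < e.growth + f.growth := by
            have := e.one_le_growth
            have := f.one_le_growth
            omega
      _ ≤ _ := Nat.le_mul_of_pos_right _ hW
  induction e with
  | lit k => exact ((lit k).eval_lt_growth h).trans_le hB
  | reg x => exact ((reg x).eval_lt_growth h).trans_le hB
  | read a ih => exact ⟨ih hB, ((read a).eval_lt_growth h).trans_le hB⟩
  | add e f he hf =>
    have := ((add e f).eval_lt_growth h).trans_le hB
    simp only [growth, add_mul] at hB
    exact ⟨he (by omega), hf (by omega), this⟩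
  | sub e f he hf =>
    simp only [growth, add_mul] at hB
    exact ⟨he (by omega), hf (by omega)⟩
  | lt e f he hf =>
    have := (one e f).trans_le hB
    simp only [growth, add_mul] at hB
    exact ⟨he (by omega), hf (by omega), this⟩
  | eq e f he hf =>
    have := (one e f).trans_le hB
    simp only [growth, add_mul] at hB
    exact ⟨he (by omega), hf (by omega), this⟩

/-- The factor by which one pass through a loop-free program may increase the largest number in
the store. -/
def Prog.growth : Prog → ℕ
  | skip => 1
  | assign _ e => e.growth
  | store a e => a.growth + e.growth
  | seq p q => p.growth * q.growth
  | ite c p q => c.growth + p.growth + q.growth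
  | loop _ _ => 1

/-- An upper bound for the running time of a loop-free program. -/
def Prog.cost : Prog → ℕ
  | skip => 1
  | assign _ e => e.cost + 1
  | store a e => a.cost + e.cost + 1
  | seq p q => p.cost + q.cost
  | ite c p q => c.cost + 1 + (p.cost + q.cost)
  | loop _ _ => 1

theorem Prog.one_le_growth (p : Prog) : 1 ≤ p.growth := by
  induction p with
  | skip => exact le_rfl
  | assign x e => exact e.one_le_growth
  | store a e => exact a.one_le_growth.trans (Nat.le_add_right _ _)
  | seq p q hp hq => exact Nat.mul_pos hp hq
  | ite c p q _ _ =>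
    have := c.one_le_growth
    simp only [growth]
    omega
  | loop c p _ => exact le_rfl

/-! ### Stores with arrays and loop-free programs over them -/

/-- A store with variables, a raw memory segment and sixteen unbounded arrays. -/
structure ArrayState where
  /-- contents of the variables -/
  var : ℕ → ℕ
  /-- contents of the raw segment -/
  raw : ℕ → ℕ
  /-- contents of the arrays -/
  arr : Fin 16 → ℕ → ℕ

namespace ArrayState

/-- Assignment to a variable. -/
def setVar (σ : ArrayState) (x a : ℕ) : ArrayState :=
  { σ with var := Function.update σ.var x a }

/-- Assignment to a cell of the raw segment. -/
def setRaw (σ : ArrayState) (i a : ℕ) : ArrayState :=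
  { σ with raw := Function.update σ.raw i a }

/-- Assignment to an array entry. -/
def setArr (σ : ArrayState) (k : Fin 16) (i a : ℕ) : ArrayState :=
  { σ with arr := Function.update σ.arr k (Function.update (σ.arr k) i a) }

variable (σ : ArrayState)

@[simp] theorem setVar_var_self (x a : ℕ) : (σ.setVar x a).var x = a := by
  simp [setVar]

@[simp] theorem setVar_var_of_ne {x y : ℕ} (a : ℕ) (h : y ≠ x) :
    (σ.setVar x a).var y = σ.var y := by
  simp [setVar, h]

@[simp] theorem setVar_raw (x a : ℕ) : (σ.setVar x a).raw = σ.raw := rfl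

@[simp] theorem setVar_arr (x a : ℕ) : (σ.setVar x a).arr = σ.arr := rfl

@[simp] theorem setRaw_var (i a : ℕ) : (σ.setRaw i a).var = σ.var := rfl

@[simp] theorem setRaw_raw (i a : ℕ) : (σ.setRaw i a).raw = Function.update σ.raw i a := rfl

@[simp] theorem setRaw_arr (i a : ℕ) : (σ.setRaw i a).arr = σ.arr := rfl

@[simp] theorem setArr_var (k : Fin 16) (i a : ℕ) : (σ.setArr k i a).var = σ.var := rfl

@[simp] theorem setArr_raw (k : Fin 16) (i a : ℕ) : (σ.setArr k i a).raw = σ.raw := rfl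

@[simp] theorem setArr_arr_self (k : Fin 16) (i a : ℕ) :
    (σ.setArr k i a).arr k = Function.update (σ.arr k) i a := by
  simp [setArr]

@[simp] theorem setArr_arr_of_ne {k l : Fin 16} (i a : ℕ) (h : l ≠ k) :
    (σ.setArr k i a).arr l = σ.arr l := by
  simp [setArr, h]

/-- All entries of `σ` are below `W`. -/
structure Below (W : ℕ) (σ : ArrayState) : Prop where
  var : ∀ x, σ.var x < W
  raw : ∀ a, σ.raw a < W
  arr : ∀ k v, σ.arr k v < W

variable {σ} {W : ℕ}

theorem Below.setVar (h : σ.Below W) {x a : ℕ} (ha : a < W) : (σ.setVar x a).Below W := by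
  refine ⟨fun y => ?_, h.raw, h.arr⟩
  by_cases e : y = x
  · subst e; simpa using ha
  · simpa [e] using h.var y

theorem Below.setRaw (h : σ.Below W) {i a : ℕ} (ha : a < W) : (σ.setRaw i a).Below W := by
  refine ⟨h.var, fun y => ?_, h.arr⟩
  rw [setRaw_raw, Function.update_apply]
  split_ifs
  · exact ha
  · exact h.raw y

theorem Below.setArr (h : σ.Below W) {k : Fin 16} {i a : ℕ} (ha : a < W) :
    (σ.setArr k i a).Below W := by
  refine ⟨h.var, h.raw, fun l y => ?_⟩
  by_cases e : l = k
  · subst e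
    rw [setArr_arr_self, Function.update_apply]
    split_ifs
    · exact ha
    · exact h.arr l y
  · rw [setArr_arr_of_ne _ _ _ e]
    exact h.arr l y

end ArrayState

/-- Expressions over an `ArrayState`. -/
inductive ArrayExpr where
  | lit (k : ℕ)
  | var (x : ℕ)
  | raw (a : ArrayExpr)
  | get (k : Fin 16) (a : ArrayExpr)
  | add (e f : ArrayExpr)
  | sub (e f : ArrayExpr)
  | lt (e f : ArrayExpr)
  | eq (e f : ArrayExpr)

namespace ArrayExpr

/-- The value of an expression. -/
def eval (σ : ArrayState) : ArrayExpr → ℕ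
  | lit k => k
  | var x => σ.var x
  | raw a => σ.raw (a.eval σ)
  | get k a => σ.arr k (a.eval σ)
  | add e f => e.eval σ + f.eval σ
  | sub e f => e.eval σ - f.eval σ
  | lt e f => if e.eval σ < f.eval σ then 1 else 0
  | eq e f => if e.eval σ = f.eval σ then 1 else 0

/-- All reads of the raw segment are at addresses below `b`. -/
def InRange (b : ℕ) (σ : ArrayState) : ArrayExpr → Prop
  | lit _ => True
  | var _ => True
  | raw a => a.InRange b σ ∧ a.eval σ < b
  | get _ a => a.InRange b σ
  | add e f => e.InRange b σ ∧ f.InRange b σ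
  | sub e f => e.InRange b σ ∧ f.InRange b σ
  | lt e f => e.InRange b σ ∧ f.InRange b σ
  | eq e f => e.InRange b σ ∧ f.InRange b σ

end ArrayExpr

/-- The expression `2 * e`. -/
def Expr.double (e : Expr) : Expr := add e e

/-- The address of the entry `a` of the array `k`: the arrays are interleaved, and register `0`
holds the address at which they start. -/
def Expr.arrayAddress (k : Fin 16) (a : Expr) : Expr :=
  add (add (reg 0) (lit k)) a.double.double.double.double

/-- Translation of expressions: variable `x` is kept in register `x + 1`. -/
def ArrayExpr.compile : ArrayExpr → Expr
  | lit k => Expr.lit k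
  | var x => Expr.reg (x + 1)
  | raw a => Expr.read a.compile
  | get k a => Expr.read (Expr.arrayAddress k a.compile)
  | add e f => Expr.add e.compile f.compile
  | sub e f => Expr.sub e.compile f.compile
  | lt e f => Expr.lt e.compile f.compile
  | eq e f => Expr.eq e.compile f.compile

/-- Loop-free programs over an `ArrayState`. -/
inductive ArrayProg where
  | skip
  | assign (x : ℕ) (e : ArrayExpr)
  | put (k : Fin 16) (a e : ArrayExpr)
  | putRaw (a e : ArrayExpr)
  | seq (p q : ArrayProg)
  | ite (c : ArrayExpr) (p q : ArrayProg)

namespace ArrayProg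

/-- The effect of a program. -/
def run : ArrayProg → ArrayState → ArrayState
  | skip, σ => σ
  | assign x e, σ => σ.setVar x (e.eval σ)
  | put k a e, σ => σ.setArr k (a.eval σ) (e.eval σ)
  | putRaw a e, σ => σ.setRaw (a.eval σ) (e.eval σ)
  | seq p q, σ => q.run (p.run σ)
  | ite c p q, σ => if c.eval σ ≠ 0 then p.run σ else q.run σ

/-- All accesses to the raw segment are at addresses below `b`. -/
def InRange (b : ℕ) : ArrayProg → ArrayState → Prop
  | skip, _ => True
  | assign _ e, σ => e.InRange b σ
  | put _ a e, σ => a.InRange b σ ∧ e.InRange b σ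
  | putRaw a e, σ => a.InRange b σ ∧ e.InRange b σ ∧ a.eval σ < b
  | seq p q, σ => p.InRange b σ ∧ q.InRange b (p.run σ)
  | ite c p q, σ => c.InRange b σ ∧ if c.eval σ ≠ 0 then p.InRange b σ else q.InRange b σ

/-- Translation of loop-free programs. -/
def compile : ArrayProg → Prog
  | skip => Prog.skip
  | assign x e => Prog.assign (x + 1) e.compile
  | put k a e => Prog.store (Expr.arrayAddress k a.compile) e.compile
  | putRaw a e => Prog.store a.compile e.compile
  | seq p q => Prog.seq p.compile q.compile
  | ite c p q => Prog.ite c.compile p.compile q.compile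

end ArrayProg

/-! ### Correctness of the compilation -/

/-- The machine store `s` represents `σ`, with the raw segment below `b` and the interleaved arrays
from `b` on. -/
structure Represents (b : ℕ) (s : State) (σ : ArrayState) : Prop where
  base : s.reg 0 = b
  var : ∀ x, s.reg (x + 1) = σ.var x
  raw : ∀ a < b, s.mem a = σ.raw a
  arr : ∀ k v, s.mem (b + (k : Fin 16) + 16 * v) = σ.arr k v

/-- The interleaving leaves no gaps: division of `a - b` by `16` shows that every address `a` from
`b` on is an entry of some array. A bound on the array state thus bounds the whole machine store. -/
theorem Represents.below {b W : ℕ} {s : State} {σ : ArrayState} (h : Represents b s σ)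
    (hσ : σ.Below W) (hb : b < W) : s.Below W := by
  constructor
  · rintro (_ | x)
    · rwa [h.base]
    · rw [h.var]; exact hσ.var x
  · intro a
    rcases lt_or_ge a b with hab | hab
    · rw [h.raw a hab]; exact hσ.raw a
    · have := h.arr ⟨(a - b) % 16, Nat.mod_lt _ (by norm_num)⟩ ((a - b) / 16)
      have e : b + (a - b) % 16 + 16 * ((a - b) / 16) = a := by omega
      rw [e] at this
      rw [this]
      exact hσ.arr _ _

theorem Expr.eval_arrayAddress (s : State) (k : Fin 16) (a : Expr) :
    (Expr.arrayAddress k a).eval s = s.reg 0 + k + 16 * a.eval s := by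
  simp only [arrayAddress, double, eval]
  omega

/-- Only reads of the raw segment need a range condition, since the arrays are unbounded. -/
theorem Represents.eval_compile {b : ℕ} {s : State} {σ : ArrayState} (h : Represents b s σ)
    (e : ArrayExpr) (he : e.InRange b σ) : e.compile.eval s = e.eval σ := by
  induction e with
  | lit k => rfl
  | var x => exact h.var x
  | raw a ih =>
    simp only [ArrayExpr.compile, Expr.eval, ArrayExpr.eval, ih he.1]
    exact h.raw _ he.2
  | get k a ih =>
    simp only [ArrayExpr.compile, Expr.eval, ArrayExpr.eval, Expr.eval_arrayAddress, ih he, h.base]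
    exact h.arr k _
  | add e f he' hf => simp only [ArrayExpr.compile, Expr.eval, ArrayExpr.eval, he' he.1, hf he.2]
  | sub e f he' hf => simp only [ArrayExpr.compile, Expr.eval, ArrayExpr.eval, he' he.1, hf he.2]
  | lt e f he' hf => simp only [ArrayExpr.compile, Expr.eval, ArrayExpr.eval, he' he.1, hf he.2]
  | eq e f he' hf => simp only [ArrayExpr.compile, Expr.eval, ArrayExpr.eval, he' he.1, hf he.2]

/-- Simulation by induction on the program. The bound `W` varies in the induction because the second
half of a sequence starts from a store that the first half has already enlarged. Writes do not
interfere: distinct array entries have distinct addresses, and none lies below `b`. -/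
theorem ArrayProg.exec_compile {B b : ℕ} (p : ArrayProg) {W : ℕ} {s : State} {σ : ArrayState}
    (h : Represents b s σ) (hs : s.Below W) (hp : p.InRange b σ)
    (hB : p.compile.growth * W ≤ B) :
    ∃ t s', Exec B p.compile s t s' ∧ t ≤ p.compile.cost ∧ Represents b s' (p.run σ) ∧
      s'.Below (p.compile.growth * W) := by
  induction p generalizing W s σ with
  | skip => exact ⟨_, _, Exec.skip s, le_rfl, h, by simpa [compile, Prog.growth] using hs⟩
  | assign x e =>
    have hg : W ≤ e.compile.growth * W := Nat.le_mul_of_pos_left _ e.compile.one_le_growth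
    refine ⟨_, _, Exec.assign _ _ s (e.compile.fits_of_growth hs hB), le_rfl, ⟨?_, ?_, h.raw, h.arr⟩,
      ?_, (hs.mono hg).2⟩
    · simpa [Function.update] using h.base
    · intro y
      simp only [run, ArrayState.setVar, Function.update_apply, h.eval_compile e hp,
        Nat.add_right_cancel_iff, h.var]
    · intro y
      simp only [Function.update_apply]
      split_ifs
      · exact e.compile.eval_lt_growth hs
      · exact (hs.mono hg).1 y
  | put k a e =>
    simp only [compile, Prog.growth] at hB ⊢
    rw [add_mul] at hB
    have hg : W ≤ e.compile.growth * W := Nat.le_mul_of_pos_left _ e.compile.one_le_growth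
    refine ⟨_, _, Exec.store _ _ s (Expr.fits_of_growth hs _ (by omega))
      (Expr.fits_of_growth hs _ (by omega)), le_rfl, ⟨h.base, h.var, ?_, ?_⟩, ?_, ?_⟩
    · intro c hc
      rw [Expr.eval_arrayAddress, h.base]
      simp only [run]
      rw [Function.update_of_ne (by omega)]
      exact h.raw c hc
    · intro k' v
      rw [Expr.eval_arrayAddress, h.base, h.eval_compile a hp.1, h.eval_compile e hp.2]
      simp only [run, ArrayState.setArr, Function.update_apply]
      have hk := k.2
      have hk' := k'.2
      by_cases hkk : k' = k
      · subst hkk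
        by_cases hv : v = a.eval σ
        · simp [hv]
        · rw [if_neg (by omega), if_pos rfl, Function.update_of_ne hv]
          exact h.arr _ _
      · rw [if_neg, if_neg hkk]
        · exact h.arr _ _
        · intro hh
          exact hkk (Fin.ext (by omega))
    · intro x
      rw [add_mul]
      have := hs.1 x
      exact this.trans_le (by omega)
    · intro c
      simp only [Function.update_apply]
      rw [add_mul]
      have := e.compile.eval_lt_growth hs
      have := hs.2 c
      split_ifs <;> omega
  | putRaw a e =>
    simp only [compile, Prog.growth] at hB ⊢
    rw [add_mul] at hB
    have hg : W ≤ e.compile.growth * W := Nat.le_mul_of_pos_left _ e.compile.one_le_growth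
    refine ⟨_, _, Exec.store _ _ s (Expr.fits_of_growth hs _ (by omega))
      (Expr.fits_of_growth hs _ (by omega)), le_rfl, ⟨h.base, h.var, ?_, ?_⟩, ?_, ?_⟩
    · intro c hc
      rw [h.eval_compile a hp.1, h.eval_compile e hp.2.1]
      simp only [run, ArrayState.setRaw, Function.update_apply, h.raw c hc]
    · intro k' v
      have := hp.2.2
      simp only [run]
      rw [h.eval_compile a hp.1, Function.update_of_ne (by omega)]
      exact h.arr _ _
    · intro x
      rw [add_mul]
      have := hs.1 x
      exact this.trans_le (by omega)
    · intro c
      simp only [Function.update_apply]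
      rw [add_mul]
      have := e.compile.eval_lt_growth hs
      have := hs.2 c
      split_ifs <;> omega
  | seq p q ihp ihq =>
    simp only [compile, Prog.growth, Prog.cost] at hB ⊢
    rw [mul_right_comm, mul_comm _ (q.compile.growth)] at hB
    have hq1 := Nat.le_mul_of_pos_left (p.compile.growth * W) q.compile.one_le_growth
    obtain ⟨t, s', he, ht, hr, hb⟩ := ihp h hs hp.1 (hq1.trans hB)
    obtain ⟨t', s'', he', ht', hr', hb'⟩ := ihq hr hb hp.2 hB
    refine ⟨_, _, he.seq he', by omega, hr', ?_⟩
    rwa [mul_comm p.compile.growth, mul_assoc]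
  | ite c p q ihp ihq =>
    simp only [compile, Prog.growth, Prog.cost] at hB ⊢
    rw [add_mul, add_mul] at hB ⊢
    have hc := h.eval_compile c hp.1
    by_cases h0 : c.eval σ ≠ 0
    · have hp' := hp.2
      rw [if_pos h0] at hp'
      obtain ⟨t, s', he, ht, hr, hb⟩ := ihp h hs hp' (by omega)
      refine ⟨_, _, Exec.ite_true (Expr.fits_of_growth hs _ (by omega)) (hc ▸ h0) he,
        by omega, ?_, hb.mono (by omega)⟩
      simpa only [run, if_pos h0] using hr
    · have hp' := hp.2
      rw [if_neg h0] at hp'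
      obtain ⟨t, s', he, ht, hr, hb⟩ := ihq h hs hp' (by omega)
      refine ⟨_, _, Exec.ite_false (Expr.fits_of_growth hs _ (by omega))
        (hc.trans (not_not.mp h0)) he, by omega, ?_, hb.mono (by omega)⟩
      simpa only [run, if_neg h0] using hr

/-! ### Total correctness with time bounds -/

/-- Started in a store that represents `σ`, the program `P` halts within `T` steps in a store that
represents a state with the property `Q`. -/
def Achieves (B b : ℕ) (P : Prog) (T : ℕ) (σ : ArrayState) (Q : ArrayState → Prop) : Prop :=
  ∀ s, Represents b s σ → ∃ t s' σ', Exec B P s t s' ∧ t ≤ T ∧ Represents b s' σ' ∧ Q σ'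

theorem Achieves.seq {B b : ℕ} {P P' : Prog} {T T' : ℕ} {σ : ArrayState}
    {Q R : ArrayState → Prop} (h : Achieves B b P T σ Q)
    (h' : ∀ σ', Q σ' → Achieves B b P' T' σ' R) : Achieves B b (P.seq P') (T + T') σ R := by
  intro s hs
  obtain ⟨t, s', σ', he, ht, hr, hq⟩ := h s hs
  obtain ⟨t', s'', σ'', he', ht', hr', hq'⟩ := h' σ' hq s' hr
  exact ⟨_, _, _, he.seq he', by omega, hr', hq'⟩

theorem Achieves.straight {B b W : ℕ} (p : ArrayProg) {σ : ArrayState} {Q : ArrayState → Prop}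
    (hσ : σ.Below W) (hb : b < W) (hB : p.compile.growth * W ≤ B) (hp : p.InRange b σ)
    (hQ : Q (p.run σ)) : Achieves B b p.compile p.compile.cost σ Q := by
  intro s hs
  obtain ⟨t, s', he, ht, hr, -⟩ := p.exec_compile hs (hs.below hσ hb) hp hB
  exact ⟨t, s', _, he, ht, hr, hQ⟩

/-- An upper bound for the cost of one pass through a loop. -/
def passCost (c : ArrayExpr) (p : ArrayProg) : ℕ := c.compile.cost + 1 + p.compile.cost

/-- The growth factor of one pass through a loop. -/
def passGrowth (c : ArrayExpr) (p : ArrayProg) : ℕ := c.compile.growth + p.compile.growth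

/-- Total correctness of a loop with invariant `I` and a measure `μ` that each pass decreases. -/
theorem Achieves.loop {B b W : ℕ} (c : ArrayExpr) (p : ArrayProg) (I : ArrayState → Prop)
    (μ : ArrayState → ℕ) (hb : b < W) (hB : passGrowth c p * W ≤ B)
    (hI : ∀ σ, I σ → σ.Below W ∧ c.InRange b σ)
    (hstep : ∀ σ, I σ → c.eval σ ≠ 0 → p.InRange b σ ∧ I (p.run σ) ∧ μ (p.run σ) < μ σ)
    {σ : ArrayState} (hσ : I σ) :
    Achieves B b (Prog.loop c.compile p.compile) ((μ σ + 1) * passCost c p) σ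
      (fun σ' => I σ' ∧ c.eval σ' = 0) := by
  unfold passGrowth at hB
  rw [add_mul] at hB
  induction hm : μ σ using Nat.strong_induction_on generalizing σ with
  | _ m ih =>
    subst hm
    intro s hs
    have hbelow := hs.below (hI σ hσ).1 hb
    have hfit : c.compile.Fits B s := c.compile.fits_of_growth hbelow (by omega)
    have hc := hs.eval_compile c (hI σ hσ).2
    by_cases h0 : c.eval σ = 0
    · refine ⟨_, s, σ, Exec.loop_false hfit (hc.trans h0), ?_, hs, hσ, h0⟩
      rw [add_mul]
      unfold passCost
      omega
    · obtain ⟨hr, hi, hlt⟩ := hstep σ hσ h0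
      -- The enlarged bound on the store is discarded: the next pass takes its bound `W` from the
      -- invariant `I`, so growth does not compound over the passes.
      obtain ⟨t, s', he, ht, hrep, -⟩ := p.exec_compile (B := B) hs hbelow hr (by omega)
      obtain ⟨t', s'', σ', he', ht', hrep', hq⟩ := ih _ hlt hi rfl s' hrep
      refine ⟨_, s'', σ', Exec.loop_true hfit (hc ▸ h0) he he', ?_, hrep', hq⟩
      have : (μ (p.run σ) + 1) * passCost c p ≤ μ σ * passCost c p :=
        Nat.mul_le_mul_right _ hlt
      rw [add_mul, one_mul]
      unfold passCost at *
      omega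

end RAM

/-! ### Depth-first search -/

namespace DepthFirst

/-- `Anc n par u w`: the vertex `u` lies on the path of parent pointers from `w` to the root `n`. -/
inductive Anc (n : ℕ) (par : ℕ → ℕ) (u : ℕ) : ℕ → Prop
  | refl : Anc n par u u
  | step {w : ℕ} : w ≠ n → Anc n par u (par w) → Anc n par u w

/-- A path of parent pointers survives a change of `par` outside a set `S` that is closed under
parents. For the search, `S` consists of the visited vertices. -/
theorem Anc.congr {n : ℕ} {par par' : ℕ → ℕ} {S : ℕ → Prop} {u w : ℕ} (h : Anc n par u w)
    (hpar : ∀ v, S v → v ≠ n → S (par v) ∧ par' v = par v) (hw : S w) : Anc n par' u w := by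
  induction h with
  | refl => exact Anc.refl
  | step hn _ ih =>
    obtain ⟨h1, h2⟩ := hpar _ hw hn
    exact Anc.step hn (h2 ▸ ih h1)

theorem Anc.of_root {n : ℕ} {par : ℕ → ℕ} {u : ℕ} (h : Anc n par u n) : u = n := by
  cases h with
  | refl => rfl
  | step hn _ => exact absurd rfl hn

/-- `x` is an entry of the list of `v`. The cells `st v, …, lim v - 2` of `raw` hold this list. -/
def Entry (raw st lim : ℕ → ℕ) (v x : ℕ) : Prop :=
  ∃ q, st v ≤ q ∧ q + 1 < lim v ∧ raw q = x

/-- The lists of the vertices `0, …, n` are well-formed. -/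
structure Lists (n : ℕ) (raw st lim : ℕ → ℕ) : Prop where
  st_lt : ∀ v ≤ n, st v < lim v
  entry_le : ∀ v ≤ n, ∀ q, st v ≤ q → q + 1 < lim v → raw q ≤ n

/-- The invariant of a depth-first search from `n`. `pre` numbers the visited vertices from `1` on
(and is `0` elsewhere), `ord` inverts it, and `ptr v` is the position of the search in the list of
`v`, which becomes `lim v` when the search retreats from `v`. -/
structure Invariant (n : ℕ) (raw st lim ptr pre par ord low : ℕ → ℕ) (cur cnt : ℕ) : Prop where
  cur_le : cur ≤ n
  pre_cur : pre cur ≠ 0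
  pre_root : pre n = 1
  par_root : par n = n
  pre_le : ∀ v ≤ n, pre v ≤ cnt
  ord_spec : ∀ i, 1 ≤ i → i ≤ cnt → ord i ≤ n ∧ pre (ord i) = i
  ord_pre : ∀ v ≤ n, pre v ≠ 0 → ord (pre v) = v
  par_spec : ∀ v < n, pre v ≠ 0 →
    par v ≤ n ∧ pre (par v) ≠ 0 ∧ pre (par v) < pre v ∧ Entry raw st lim (par v) v
  st_le_ptr : ∀ v ≤ n, st v ≤ ptr v
  ptr_le_lim : ∀ v ≤ n, ptr v ≤ lim v
  ptr_new : ∀ v ≤ n, pre v = 0 → ptr v = st v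
  scanned : ∀ v ≤ n, ∀ q, st v ≤ q → q < ptr v → q + 1 < lim v → pre (raw q) ≠ 0
  active : ∀ v ≤ n, pre v ≠ 0 → ptr v < lim v → Anc n par v cur
  active_par : ∀ v < n, pre v ≠ 0 → ptr v < lim v → ptr (par v) < lim (par v)
  active_cur : ptr cur < lim cur ∨ cur = n
  edge : ∀ u ≤ n, ∀ w ≤ n, pre u ≠ 0 → Entry raw st lim u w → pre u < pre w → Anc n par u w
  low_iff : ∀ v ≤ n, pre v ≠ 0 → ∀ k ≤ pre v,
    (low v < k ↔ ∃ q, st v ≤ q ∧ q < ptr v ∧ q + 1 < lim v ∧ pre (raw q) < k)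
  low_new : ∀ v ≤ n, pre v = 0 → low v = n + 2

namespace Invariant

variable {n : ℕ} {raw st lim ptr pre par ord low : ℕ → ℕ} {cur cnt : ℕ}

/-- `ord` is injective on `1, …, cnt`, having `pre` as a left inverse, and takes values in `0, …,
n`. -/
theorem cnt_le (h : Invariant n raw st lim ptr pre par ord low cur cnt) : cnt ≤ n + 1 := by
  have : (Finset.Icc 1 cnt).card ≤ (Finset.range (n + 1)).card := by
    apply Finset.card_le_card_of_injOn ord
    · intro i hi
      have hi := Finset.mem_Icc.mp hi
      have := (h.ord_spec i hi.1 hi.2).1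
      simp
      omega
    · intro i hi j hj hij
      have hi := Finset.mem_Icc.mp hi
      have hj := Finset.mem_Icc.mp hj
      rw [← (h.ord_spec i hi.1 hi.2).2, ← (h.ord_spec j hj.1 hj.2).2, hij]
  simpa using this

theorem pre_le_of_anc (h : Invariant n raw st lim ptr pre par ord low cur cnt) {u w : ℕ}
    (ha : Anc n par u w) (hw : w ≤ n) (hp : pre w ≠ 0) : pre u ≤ pre w := by
  induction ha with
  | refl => exact le_rfl
  | step hn _ ih =>
    obtain ⟨h1, h2, h3, -⟩ := h.par_spec _ (lt_of_le_of_ne hw hn) hp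
    exact (ih h1 h2).trans h3.le

/-- The search retreats from `cur` to its parent. -/
theorem retreat (h : Invariant n raw st lim ptr pre par ord low cur cnt)
    (hcur : ptr cur + 1 = lim cur) :
    Invariant n raw st lim (Function.update ptr cur (ptr cur + 1)) pre par ord low
      (par cur) cnt := by
  have hpar : par cur ≤ n ∧ pre (par cur) ≠ 0 := by
    rcases h.cur_le.lt_or_eq with hc | hc
    · have := h.par_spec cur hc h.pre_cur
      exact ⟨this.1, this.2.1⟩
    · rw [hc, h.par_root]
      exact ⟨le_rfl, by simp [h.pre_root]⟩
  refine { h with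
    cur_le := hpar.1
    pre_cur := hpar.2
    st_le_ptr := ?_, ptr_le_lim := ?_, ptr_new := ?_, scanned := ?_, active := ?_
    active_par := ?_, active_cur := ?_, low_iff := ?_ }
  · intro v hv
    have := h.st_le_ptr v hv
    simp only [Function.update_apply]; split_ifs with e
    · subst e; omega
    · exact this
  · intro v hv
    have := h.ptr_le_lim v hv
    simp only [Function.update_apply]; split_ifs with e
    · subst e; omega
    · exact this
  · intro v hv hp
    have hvc : v ≠ cur := by rintro rfl; exact h.pre_cur hp
    rw [Function.update_of_ne hvc]
    exact h.ptr_new v hv hp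
  · intro v hv q h1 h2 h3
    refine h.scanned v hv q h1 ?_ h3
    rw [Function.update_apply] at h2
    split_ifs at h2 with e
    · subst e; omega
    · exact h2
  · intro v hv hp hlt
    rw [Function.update_apply] at hlt
    split_ifs at hlt with e
    · subst e; omega
    · rcases h.active v hv hp hlt with _ | ⟨_, ha⟩
      · exact absurd rfl e
      · exact ha
  · intro v hv hp hlt
    rw [Function.update_apply] at hlt
    split_ifs at hlt with e
    · subst e; omega
    · rw [Function.update_of_ne]
      · exact h.active_par v hv hp hlt
      · intro e'
        -- An active `v` is an ancestor of `cur`, so its number is at most that of `cur`; its parent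
        -- has a smaller number still and cannot be `cur`.
        have := h.pre_le_of_anc (h.active v hv.le hp hlt) h.cur_le h.pre_cur
        have := (h.par_spec v hv hp).2.2.1
        rw [e'] at this
        omega
  · rcases h.cur_le.lt_or_eq with hc | hc
    · left
      rw [Function.update_of_ne]
      · exact h.active_par cur hc h.pre_cur (by omega)
      · intro e
        have := (h.par_spec cur hc h.pre_cur).2.2.1
        rw [e] at this
        omega
    · right
      rw [hc, h.par_root]
  · intro v hv hp k hk
    rw [h.low_iff v hv hp k hk]
    -- The position passed here is `lim cur - 1`, one past the last entry, so no entry is added to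
    -- the scanned ones.
    refine exists_congr fun q => and_congr_right fun _ => ?_
    rw [Function.update_apply]
    split_ifs with e
    · subst e
      refine and_congr_left fun h2 => ?_
      omega
    · rfl

/-- The search moves on past an entry that was visited before. -/
theorem skip (h : Invariant n raw st lim ptr pre par ord low cur cnt)
    (hcur : ptr cur + 1 < lim cur) (hx : pre (raw (ptr cur)) ≠ 0) :
    Invariant n raw st lim (Function.update ptr cur (ptr cur + 1)) pre par ord
      (Function.update low cur (min (low cur) (pre (raw (ptr cur))))) cur cnt := by
  have hst := h.st_le_ptr cur h.cur_le
  have hact : ∀ v, Function.update ptr cur (ptr cur + 1) v < lim v ↔ ptr v < lim v := by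
    intro v
    rw [Function.update_apply]
    split_ifs with e
    · subst e; omega
    · rfl
  refine { h with
    st_le_ptr := ?_, ptr_le_lim := ?_, ptr_new := ?_, scanned := ?_, active := ?_
    active_par := ?_, active_cur := ?_, low_iff := ?_, low_new := ?_ }
  · intro v hv
    have := h.st_le_ptr v hv
    simp only [Function.update_apply]; split_ifs with e
    · subst e; omega
    · exact this
  · intro v hv
    have := h.ptr_le_lim v hv
    simp only [Function.update_apply]; split_ifs with e
    · subst e; omega
    · exact this
  · intro v hv hp
    have hvc : v ≠ cur := by rintro rfl; exact h.pre_cur hp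
    rw [Function.update_of_ne hvc]
    exact h.ptr_new v hv hp
  · intro v hv q h1 h2 h3
    rw [Function.update_apply] at h2
    split_ifs at h2 with e
    · subst e
      rcases (Nat.lt_succ_iff.mp h2).lt_or_eq with h4 | h4
      · exact h.scanned v hv q h1 h4 h3
      · rwa [h4]
    · exact h.scanned v hv q h1 h2 h3
  · intro v hv hp hlt
    exact h.active v hv hp ((hact v).mp hlt)
  · intro v hv hp hlt
    exact (hact _).mpr (h.active_par v hv hp ((hact v).mp hlt))
  · exact h.active_cur.imp_left (hact _).mpr
  · intro v hv hp k hk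
    have := h.low_iff v hv hp k hk
    by_cases e : v = cur
    · subst e
      rw [Function.update_self, Function.update_self, min_lt_iff, this]
      constructor
      · rintro (⟨q, h1, h2, h3, h4⟩ | h4)
        · exact ⟨q, h1, by omega, h3, h4⟩
        · exact ⟨ptr v, hst, by omega, hcur, h4⟩
      · rintro ⟨q, h1, h2, h3, h4⟩
        rcases (Nat.lt_succ_iff.mp h2).lt_or_eq with h5 | h5
        · exact Or.inl ⟨q, h1, h5, h3, h4⟩
        · exact Or.inr (h5 ▸ h4)
    · rw [Function.update_of_ne e, Function.update_of_ne e, this]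
  · intro v hv hp
    have hvc : v ≠ cur := by rintro rfl; exact h.pre_cur hp
    rw [Function.update_of_ne hvc]
    exact h.low_new v hv hp

/-- The search discovers a new vertex. -/
theorem discover (h : Invariant n raw st lim ptr pre par ord low cur cnt)
    (hl : Lists n raw st lim) (hcur : ptr cur + 1 < lim cur) {x : ℕ} (hx : raw (ptr cur) = x)
    (hpx : pre x = 0) :
    Invariant n raw st lim (Function.update ptr cur (ptr cur + 1))
      (Function.update pre x (cnt + 1)) (Function.update par x cur)
      (Function.update ord (cnt + 1) x) low x (cnt + 1) := by
  have hst := h.st_le_ptr cur h.cur_le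
  have hxn : x ≤ n := hx ▸ hl.entry_le cur h.cur_le _ hst hcur
  have hxroot : x ≠ n := by rintro rfl; simp [h.pre_root] at hpx
  have hxlt : x < n := lt_of_le_of_ne hxn hxroot
  have hne : ∀ {v}, pre v ≠ 0 → v ≠ x := fun hv e => hv (e ▸ hpx)
  have hcx : cur ≠ x := hne h.pre_cur
  have hcnt : cnt + 1 ≠ 0 := Nat.succ_ne_zero _
  have hact : ∀ v, Function.update ptr cur (ptr cur + 1) v < lim v ↔ ptr v < lim v := by
    intro v
    rw [Function.update_apply]
    split_ifs with e
    · subst e; omega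
    · rfl
  have hpar : ∀ v, (v ≤ n ∧ pre v ≠ 0) → v ≠ n →
      (par v ≤ n ∧ pre (par v) ≠ 0) ∧ Function.update par x cur v = par v := by
    intro v hv hvn
    have := h.par_spec v (lt_of_le_of_ne hv.1 hvn) hv.2
    exact ⟨⟨this.1, this.2.1⟩, Function.update_of_ne (hne hv.2) _ _⟩
  have hanc : ∀ {u w}, Anc n par u w → w ≤ n → pre w ≠ 0 → Anc n (Function.update par x cur) u w :=
    fun ha hw hp => ha.congr hpar ⟨hw, hp⟩
  have hancx : ∀ {u}, Anc n par u cur → Anc n (Function.update par x cur) u x := by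
    intro u ha
    refine Anc.step hxroot ?_
    rw [Function.update_self]
    exact hanc ha h.cur_le h.pre_cur
  have hscan : ∀ v ≤ n, ∀ q, st v ≤ q → q < Function.update ptr cur (ptr cur + 1) v →
      q + 1 < lim v → q < ptr v ∧ pre (raw q) ≠ 0 ∨ v = cur ∧ raw q = x := by
    intro v hv q h1 h2 h3
    by_cases hq : q < ptr v
    · exact Or.inl ⟨hq, h.scanned v hv q h1 hq h3⟩
    · rw [Function.update_apply] at h2
      split_ifs at h2 with e
      · subst e
        have : q = ptr v := by omega
        exact Or.inr ⟨rfl, this ▸ hx⟩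
      · omega
  refine {
    cur_le := hxn
    pre_cur := by simp
    pre_root := by rw [Function.update_of_ne hxroot.symm, h.pre_root]
    par_root := by rw [Function.update_of_ne hxroot.symm, h.par_root]
    pre_le := ?_, ord_spec := ?_, ord_pre := ?_, par_spec := ?_, st_le_ptr := ?_
    ptr_le_lim := ?_, ptr_new := ?_, scanned := ?_, active := ?_
    active_par := ?_, active_cur := ?_, edge := ?_, low_iff := ?_, low_new := ?_ }
  · intro v hv
    have := h.pre_le v hv
    rw [Function.update_apply]; split_ifs <;> omega
  · intro i h1 h2
    by_cases e : i = cnt + 1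
    · subst e; simp [hxn]
    · obtain ⟨h3, h4⟩ := h.ord_spec i h1 (by omega)
      rw [Function.update_of_ne e, Function.update_of_ne (hne (by omega))]
      exact ⟨h3, h4⟩
  · intro v hv hp
    by_cases e : v = x
    · subst e; simp
    · rw [Function.update_of_ne e] at hp ⊢
      have := h.pre_le v hv
      rw [Function.update_of_ne (by omega)]
      exact h.ord_pre v hv hp
  · intro v hv hp
    by_cases e : v = x
    · subst e
      have := h.pre_le cur h.cur_le
      rw [Function.update_self, Function.update_self, Function.update_of_ne hcx]
      exact ⟨h.cur_le, h.pre_cur, by omega, ptr cur, hst, hcur, hx⟩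
    · rw [Function.update_of_ne e] at hp ⊢
      obtain ⟨h1, h2, h3, h4⟩ := h.par_spec v hv hp
      rw [Function.update_of_ne e, Function.update_of_ne (hne h2)]
      exact ⟨h1, h2, h3, h4⟩
  · intro v hv
    have := h.st_le_ptr v hv
    simp only [Function.update_apply]; split_ifs with e
    · subst e; omega
    · exact this
  · intro v hv
    have := h.ptr_le_lim v hv
    simp only [Function.update_apply]; split_ifs with e
    · subst e; omega
    · exact this
  · intro v hv hp
    have hvx : v ≠ x := by rintro rfl; simp at hp
    rw [Function.update_of_ne hvx] at hp
    have hvc : v ≠ cur := by rintro rfl; exact h.pre_cur hp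
    rw [Function.update_of_ne hvc]
    exact h.ptr_new v hv hp
  · intro v hv q h1 h2 h3
    rcases hscan v hv q h1 h2 h3 with ⟨-, h4⟩ | ⟨-, h4⟩
    · rwa [Function.update_of_ne (hne h4)]
    · simp [h4]
  · intro v hv hp hlt
    by_cases e : v = x
    · subst e; exact Anc.refl
    · rw [Function.update_of_ne e] at hp
      exact hancx (h.active v hv hp ((hact v).mp hlt))
  · intro v hv hp hlt
    rw [hact] at hlt ⊢
    by_cases e : v = x
    · subst e
      rw [Function.update_self]
      omega
    · rw [Function.update_of_ne e] at hp ⊢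
      exact h.active_par v hv hp hlt
  · left
    rw [hact, h.ptr_new x hxn hpx]
    exact hl.st_lt x hxn
  · intro u hu w hw hp he hlt
    by_cases eu : u = x
    · subst eu
      have := h.pre_le w hw
      rw [Function.update_self, Function.update_apply] at hlt
      split_ifs at hlt <;> omega
    · rw [Function.update_of_ne eu] at hp hlt
      by_cases ew : w = x
      · subst ew
        apply hancx
        -- The heart of the search: a visited `u` with `x` in its list must still be active, since
        -- otherwise its whole list would have been scanned and `x` visited. Active vertices are
        -- ancestors of `cur`, hence of its new child `x`.
        apply h.active u hu hp
        by_contra hpop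
        obtain ⟨q, h1, h2, h3⟩ := he
        exact h.scanned u hu q h1 (by omega) h2 (h3 ▸ hpx)
      · rw [Function.update_of_ne ew] at hlt
        exact hanc (h.edge u hu w hw hp he hlt) hw (by omega)
  · intro v hv hp k hk
    by_cases e : v = x
    · subst e
      have hc := h.cnt_le
      have hlow := h.low_new v hv hpx
      rw [Function.update_self] at hk
      constructor
      -- The initial value `n + 2` acts as infinity, because `k ≤ cnt + 1 ≤ n + 2`.
      · intro hh; omega
      · rintro ⟨q, h1, h2, -⟩
        rw [Function.update_of_ne hcx.symm, h.ptr_new v hv hpx] at h2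
        omega
    · rw [Function.update_of_ne e] at hp hk
      have hpv := h.pre_le v hv
      rw [h.low_iff v hv hp k hk]
      constructor
      · rintro ⟨q, h1, h2, h3, h4⟩
        refine ⟨q, h1, ?_, h3, ?_⟩
        · rw [Function.update_apply]
          split_ifs with e'
          · subst e'; omega
          · exact h2
        · rwa [Function.update_of_ne (hne (h.scanned v hv q h1 h2 h3))]
      · rintro ⟨q, h1, h2, h3, h4⟩
        rcases hscan v hv q h1 h2 h3 with ⟨h5, h6⟩ | ⟨h5, h6⟩
        · rw [Function.update_of_ne (hne h6)] at h4
          exact ⟨q, h1, h5, h3, h4⟩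
        -- A tree edge is not entered into `low`. This is harmless since the new number `cnt + 1`
        -- exceeds `pre v ≥ k`; it is why `low_iff` is only claimed for `k ≤ pre v`.
        · rw [h6, Function.update_self] at h4
          omega
  · intro v hv hp
    have hvx : v ≠ x := by rintro rfl; simp at hp
    rw [Function.update_of_ne hvx] at hp
    exact h.low_new v hv hp

end Invariant

/-! ### The finished search -/

/-- The result of a depth-first search from `n` that reaches all vertices `0, …, n - 1`. -/
structure Forest (n : ℕ) (Nb : ℕ → ℕ → Prop) (pre par ord : ℕ → ℕ) : Prop where
  pre_root : pre n = 1
  pre_le : ∀ v ≤ n, pre v ≤ n + 1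
  ord_spec : ∀ i, 1 ≤ i → i ≤ n + 1 → ord i ≤ n ∧ pre (ord i) = i
  ord_pre : ∀ v ≤ n, ord (pre v) = v
  par_le : ∀ v < n, par v ≤ n
  pre_par_lt : ∀ v < n, pre (par v) < pre v
  nb_par : ∀ v < n, Nb (par v) v
  edge : ∀ u ≤ n, ∀ w ≤ n, Nb u w → pre u < pre w → Anc n par u w

/-- When the search has ended, it has built a spanning forest, and `low` compares with the numbers
of the neighbours. -/
theorem Invariant.forest {n : ℕ} {raw st lim ptr pre par ord low : ℕ → ℕ} {cur cnt : ℕ}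
    (h : Invariant n raw st lim ptr pre par ord low cur cnt)
    (hroot : ∀ v < n, Entry raw st lim n v) (hend : lim cur ≤ ptr cur) :
    Forest n (Entry raw st lim) pre par ord ∧
      ∀ v ≤ n, ∀ k ≤ pre v, (low v < k ↔ ∃ x, Entry raw st lim v x ∧ pre x < k) := by
  have hcur : cur = n := h.active_cur.resolve_left (by omega)
  subst hcur
  -- The root has scanned its whole list, which contains every vertex.
  have hvis : ∀ v ≤ cur, pre v ≠ 0 := by
    intro v hv
    rcases hv.lt_or_eq with hv | rfl
    · obtain ⟨q, h1, h2, rfl⟩ := hroot v hv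
      exact h.scanned cur le_rfl q h1 (by omega) h2
    · exact h.pre_cur
  -- An active vertex would be an ancestor of the root, hence the root, whose list is exhausted.
  have hpop : ∀ v ≤ cur, lim v ≤ ptr v := by
    intro v hv
    by_contra hlt
    obtain rfl := (h.active v hv (hvis v hv) (by omega)).of_root
    omega
  have hcnt : cnt = cur + 1 := by
    refine le_antisymm h.cnt_le ?_
    have : (Finset.range (cur + 1)).card ≤ (Finset.Icc 1 cnt).card := by
      apply Finset.card_le_card_of_injOn pre
      · intro v hv
        have hv : v ≤ cur := by simpa [Nat.lt_succ_iff] using hv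
        have := hvis v hv
        have := h.pre_le v hv
        simp
        omega
      · intro v hv w hw hvw
        have hv : v ≤ cur := by simpa [Nat.lt_succ_iff] using hv
        have hw : w ≤ cur := by simpa [Nat.lt_succ_iff] using hw
        rw [← h.ord_pre v hv (hvis v hv), ← h.ord_pre w hw (hvis w hw), hvw]
    simpa using this
  subst hcnt
  refine ⟨⟨h.pre_root, h.pre_le, h.ord_spec, fun v hv => h.ord_pre v hv (hvis v hv),
    fun v hv => (h.par_spec v hv (hvis v hv.le)).1,
    fun v hv => (h.par_spec v hv (hvis v hv.le)).2.2.1,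
    fun v hv => (h.par_spec v hv (hvis v hv.le)).2.2.2,
    fun u hu w hw => h.edge u hu w hw (hvis u hu)⟩, ?_⟩
  intro v hv k hk
  rw [h.low_iff v hv (hvis v hv) k hk]
  have := hpop v hv
  constructor
  · rintro ⟨q, h1, _, h3, h4⟩
    exact ⟨_, ⟨q, h1, h3, rfl⟩, h4⟩
  · rintro ⟨x, ⟨q, h1, h2, rfl⟩, h3⟩
    exact ⟨q, h1, by omega, h2, h3⟩

/-- The state at the start of the search. -/
theorem Invariant.start {n : ℕ} {raw st lim ptr pre par ord low : ℕ → ℕ}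
    (hl : Lists n raw st lim) (hptr : ∀ v ≤ n, ptr v = st v) (hroot : pre n = 1)
    (hpre : ∀ v < n, pre v = 0) (hpar : par n = n) (hord : ord 1 = n)
    (hlow : ∀ v ≤ n, low v = n + 2) :
    Invariant n raw st lim ptr pre par ord low n 1 := by
  have hvis : ∀ v ≤ n, pre v ≠ 0 → v = n := by
    intro v hv hp
    by_contra hne
    exact hp (hpre v (lt_of_le_of_ne hv hne))
  have hle : ∀ v ≤ n, pre v ≤ 1 := by
    intro v hv
    by_cases hp : pre v = 0
    · omega
    · rw [hvis v hv hp, hroot]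
  refine {
    cur_le := le_rfl
    pre_cur := by simp [hroot]
    pre_root := hroot
    par_root := hpar
    pre_le := hle
    ord_spec := ?_, ord_pre := ?_, par_spec := ?_
    st_le_ptr := fun v hv => (hptr v hv).ge
    ptr_le_lim := fun v hv => (hptr v hv).le.trans (hl.st_lt v hv).le
    ptr_new := fun v hv _ => hptr v hv
    scanned := ?_, active := ?_, active_par := ?_
    active_cur := Or.inr rfl
    edge := ?_, low_iff := ?_
    low_new := fun v hv _ => hlow v hv }
  · intro i h1 h2
    obtain rfl : i = 1 := by omega
    rw [hord]
    exact ⟨le_rfl, hroot⟩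
  · intro v hv hp
    rw [hvis v hv hp, hroot, hord]
  · exact fun v hv hp => absurd (hpre v hv) hp
  · intro v hv q h1 h2
    rw [hptr v hv] at h2
    omega
  · intro v hv hp _
    rw [hvis v hv hp]
    exact Anc.refl
  · exact fun v hv hp => absurd (hpre v hv) hp
  · intro u hu w hw hp _ hlt
    have := hle w hw
    omega
  · intro v hv hp k hk
    have := hle v hv
    have := hlow v hv
    constructor
    · intro; omega
    · rintro ⟨q, h1, h2, _⟩
      rw [hptr v hv] at h2
      omega

end DepthFirst

/-! ### Removal of a vertex -/

namespace SimpleGraph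

variable {V : Type*} {G : SimpleGraph V} {v : V}

/-- Induction along a walk. Closed sets give upper bounds for components. -/
theorem mem_of_reachable_removeVertex {S : Set V}
    (hS : ∀ x ∈ S, ∀ y, y ≠ v → G.Adj x y → y ∈ S) {a b : ({v}ᶜ : Set V)}
    (h : (G.removeVertex v).Reachable a b) (ha : (a : V) ∈ S) : (b : V) ∈ S := by
  obtain ⟨p⟩ := h
  induction p with
  | nil => exact ha
  | @cons x y z hadj _ ih => exact ih (hS x ha y y.2 hadj)

theorem reachable_of_removeVertex {a b : ({v}ᶜ : Set V)}
    (h : (G.removeVertex v).Reachable a b) : G.Reachable (a : V) (b : V) :=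
  h.map (Embedding.induce _).toHom

/-- A walk that starts outside the component of `v` never meets `v`, so it survives the removal
unchanged. -/
theorem reachable_removeVertex_of_not_reachable {a b : V} (h : G.Reachable a b)
    (ha : ¬ G.Reachable v a) (hav : a ≠ v) (hbv : b ≠ v) :
    (G.removeVertex v).Reachable ⟨a, hav⟩ ⟨b, hbv⟩ := by
  obtain ⟨p⟩ := h
  induction p with
  | nil => exact Reachable.refl _
  | @cons x y z hadj _ ih =>
    have hy : ¬ G.Reachable v y := fun h => ha (h.trans hadj.symm.reachable)
    have hyv : y ≠ v := fun h => hy (h ▸ Reachable.refl _)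
    have hxy : (G.removeVertex v).Adj ⟨x, hav⟩ ⟨y, hyv⟩ := hadj
    exact hxy.reachable.trans (ih hy hyv hbv)

/-- The vertices other than `v` that can be reached from `v`. -/
def otherReachable (G : SimpleGraph V) (v : V) : Set V := {w | w ≠ v ∧ G.Reachable v w}

theorem survivingSize_mem {a : V} (ha : a ∈ G.otherReachable v) :
    ((G.removeVertex v).connectedComponentMk ⟨a, ha.1⟩).supp.ncard ∈ G.survivingSizes v := by
  refine ⟨_, ?_, rfl⟩
  intro w hw
  have := ConnectedComponent.exact ((ConnectedComponent.mem_supp_iff _ _).mp hw)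
  exact ha.2.trans (reachable_of_removeVertex this).symm

section Finite

variable [Finite V]

theorem survivingSizes_bddAbove : BddAbove (G.survivingSizes v) := by
  refine ⟨(Set.univ : Set ({v}ᶜ : Set V)).ncard, ?_⟩
  rintro _ ⟨C, -, rfl⟩
  exact Set.ncard_le_ncard (Set.subset_univ _)

/-- A surviving component is contained in any closed set that it meets. If nothing survives, the
supremum of the empty set of sizes is `0`. -/
theorem sSup_survivingSizes_le {M : ℕ}
    (h : ∀ w ∈ G.otherReachable v, ∃ S : Set V, w ∈ S ∧ S.ncard ≤ M ∧
      ∀ x ∈ S, ∀ y, y ≠ v → G.Adj x y → y ∈ S) : sSup (G.survivingSizes v) ≤ M := by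
  rcases (G.survivingSizes v).eq_empty_or_nonempty with he | hne
  · simp [he]
  · refine csSup_le hne ?_
    rintro _ ⟨C, hC, rfl⟩
    obtain ⟨a, rfl⟩ := C.exists_rep
    obtain ⟨S, haS, hS, hcl⟩ := h a ⟨a.2, hC a rfl⟩
    refine le_trans ?_ hS
    rw [← Set.ncard_image_of_injective _ Subtype.val_injective]
    refine Set.ncard_le_ncard ?_
    rintro _ ⟨b, hb, rfl⟩
    exact mem_of_reachable_removeVertex hcl (ConnectedComponent.exact hb).symm haS

/-- A set that stays connected lies inside a single surviving component. -/
theorem le_sSup_survivingSizes {S : Set V} (hS : S ⊆ G.otherReachable v)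
    (hconn : ∀ a ∈ S, ∀ b ∈ S, ∃ ha hb, (G.removeVertex v).Reachable ⟨a, ha⟩ ⟨b, hb⟩) :
    S.ncard ≤ sSup (G.survivingSizes v) := by
  rcases S.eq_empty_or_nonempty with rfl | ⟨a, ha⟩
  · simp
  · refine le_trans ?_ (le_csSup survivingSizes_bddAbove (survivingSize_mem (hS ha)))
    rw [← Set.ncard_image_of_injective _ Subtype.val_injective]
    refine Set.ncard_le_ncard ?_
    intro b hb
    obtain ⟨_, hbv, hr⟩ := hconn a ha b hb
    exact ⟨⟨b, hbv⟩, ConnectedComponent.sound hr.symm, rfl⟩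

/-- The articulation points are the vertices of positive impact. -/
theorem isArticulationPoint_iff_impact_pos :
    G.IsArticulationPoint v ↔ 0 < G.impact v := by
  -- Inclusion sends each component of the graph without `v` to the component of `G` around it.
  -- Counting components then becomes a question of injectivity and surjectivity of `φ`.
  let φ : (G.removeVertex v).ConnectedComponent → G.ConnectedComponent :=
    ConnectedComponent.map (Embedding.induce _).toHom
  have hφ : ∀ a, φ ((G.removeVertex v).connectedComponentMk a) = G.connectedComponentMk a :=
    fun _ => rfl
  have himp : G.impact v = (G.otherReachable v).ncard - sSup (G.survivingSizes v) := rfl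
  rw [himp, Nat.sub_pos_iff_lt]
  constructor
  · intro hart
    by_contra hle
    rw [not_lt] at hle
    refine absurd hart (not_lt.mpr (Nat.card_le_card_of_injective φ ?_))
    intro C₁ C₂
    obtain ⟨a, rfl⟩ := C₁.exists_rep
    obtain ⟨b, rfl⟩ := C₂.exists_rep
    intro hab
    have hab : G.Reachable (a : V) (b : V) := ConnectedComponent.exact hab
    refine ConnectedComponent.sound ?_
    by_cases hva : G.Reachable v a
    · have haD : (a : V) ∈ G.otherReachable v := ⟨a.2, hva⟩
      have hbD : (b : V) ∈ G.otherReachable v := ⟨b.2, hva.trans hab⟩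
      -- With impact `0`, a largest surviving component already contains all other vertices
      -- reachable from `v`, so `a` and `b` both lie in it.
      obtain ⟨C, hC, hcard⟩ := Nat.sSup_mem ⟨_, survivingSize_mem haD⟩ survivingSizes_bddAbove
      have himage : Subtype.val '' C.supp = G.otherReachable v := by
        refine Set.eq_of_subset_of_ncard_le ?_ ?_
        · rintro _ ⟨w, hw, rfl⟩
          exact ⟨w.2, hC w hw⟩
        · rw [Set.ncard_image_of_injective _ Subtype.val_injective, hcard]
          exact hle
      rw [← himage] at haD hbD
      obtain ⟨a', ha', e⟩ := haD
      obtain rfl := Subtype.ext e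
      obtain ⟨b', hb', e⟩ := hbD
      obtain rfl := Subtype.ext e
      exact ConnectedComponent.exact
        (((ConnectedComponent.mem_supp_iff _ _).mp ha').trans
          ((ConnectedComponent.mem_supp_iff _ _).mp hb').symm)
    · exact reachable_removeVertex_of_not_reachable hab hva a.2 b.2
  · intro hlt
    obtain ⟨a, ha⟩ : (G.otherReachable v).Nonempty := by
      rw [Set.nonempty_iff_ne_empty]
      intro he
      simp [he] at hlt
    have hmem := survivingSize_mem ha
    obtain ⟨b, hb, hba⟩ : ∃ b ∈ G.otherReachable v,
        b ∉ Subtype.val '' ((G.removeVertex v).connectedComponentMk ⟨a, ha.1⟩).supp := by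
      refine Set.exists_mem_notMem_of_ncard_lt_ncard ?_
      rw [Set.ncard_image_of_injective _ Subtype.val_injective]
      exact (le_csSup survivingSizes_bddAbove hmem).trans_lt hlt
    -- Only the component of `v` could be missed, and it contains `a ≠ v`. As `a` and `b` are
    -- separated by the removal, `φ` is surjective but not injective, which makes the count strictly
    -- larger.
    have hsurj : Function.Surjective φ := by
      intro K
      obtain ⟨w, rfl⟩ := K.exists_rep
      by_cases hw : w = v
      · subst hw
        exact ⟨_, (hφ ⟨a, ha.1⟩).trans (ConnectedComponent.sound ha.2.symm)⟩
      · exact ⟨_, hφ ⟨w, hw⟩⟩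
    have hinj : ¬ Function.Injective φ := by
      intro hinj
      refine hba ⟨⟨b, hb.1⟩, ?_, rfl⟩
      rw [ConnectedComponent.mem_supp_iff]
      apply hinj
      rw [hφ, hφ]
      exact ConnectedComponent.sound (hb.2.symm.trans ha.2)
    refine lt_of_le_of_ne (Nat.card_le_card_of_surjective φ hsurj) ?_
    intro he
    exact hinj ((Nat.bijective_iff_surjective_and_card φ).mpr ⟨hsurj, he.symm⟩).1

end Finite

end SimpleGraph

/-! ### Impact in terms of a depth-first search forest -/

namespace DepthFirst

/-- The vertices with parent `v`. -/
def children (n : ℕ) (par : ℕ → ℕ) (v : ℕ) : Finset ℕ :=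
  (Finset.range n).filter fun c => par c = v

open Classical in
/-- The vertices of the subtree below `v`. -/
noncomputable def subtree (n : ℕ) (par : ℕ → ℕ) (v : ℕ) : Finset ℕ :=
  (Finset.range (n + 1)).filter (Anc n par v)

/-- Some neighbour of the subtree below `c` has a number below `k`. -/
def Escapes (n : ℕ) (Nb : ℕ → ℕ → Prop) (pre par : ℕ → ℕ) (c k : ℕ) : Prop :=
  ∃ w ≤ n, ∃ x, Anc n par c w ∧ Nb w x ∧ pre x < k

open Classical in
/-- The children of `v` below which no vertex is adjacent to a proper ancestor of `v`. -/
noncomputable def cutChildren (n : ℕ) (Nb : ℕ → ℕ → Prop) (pre par : ℕ → ℕ) (v : ℕ) : Finset ℕ :=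
  (children n par v).filter fun c => ¬ Escapes n Nb pre par c (pre v)

theorem mem_children {n : ℕ} {par : ℕ → ℕ} {v c : ℕ} :
    c ∈ children n par v ↔ c < n ∧ par c = v := by
  simp [children]

theorem mem_subtree {n : ℕ} {par : ℕ → ℕ} {v w : ℕ} :
    w ∈ subtree n par v ↔ w ≤ n ∧ Anc n par v w := by
  simp [subtree]

theorem mem_cutChildren {n : ℕ} {Nb : ℕ → ℕ → Prop} {pre par : ℕ → ℕ} {v c : ℕ} :
    c ∈ cutChildren n Nb pre par v ↔
      (c < n ∧ par c = v) ∧ ¬ Escapes n Nb pre par c (pre v) := by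
  simp [cutChildren, mem_children]

theorem Anc.trans {n : ℕ} {par : ℕ → ℕ} {a b c : ℕ} (hab : Anc n par a b) (hbc : Anc n par b c) :
    Anc n par a c := by
  induction hbc with
  | refl => exact hab
  | step hn _ ih => exact Anc.step hn ih

/-- The ancestors of a vertex form a chain, because the parent is unique. -/
theorem Anc.total {n : ℕ} {par : ℕ → ℕ} {a b w : ℕ} (ha : Anc n par a w) (hb : Anc n par b w) :
    Anc n par a b ∨ Anc n par b a := by
  induction ha with
  | refl => exact Or.inr hb
  | step hn ha' ih =>
    cases hb with
    | refl => exact Or.inl (Anc.step hn ha')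
    | step _ hb' => exact ih hb'

theorem Anc.par_of_ne {n : ℕ} {par : ℕ → ℕ} {a w : ℕ} (h : Anc n par a w) (hne : a ≠ w) :
    Anc n par a (par w) := by
  cases h with
  | refl => exact absurd rfl hne
  | step _ h => exact h

/-! ### Ancestors and subtrees -/

namespace Forest

variable {n : ℕ} {Nb : ℕ → ℕ → Prop} {pre par ord : ℕ → ℕ}

theorem anc_le (F : Forest n Nb pre par ord) {u w : ℕ} (h : Anc n par u w) (hw : w ≤ n) :
    u ≤ n ∧ pre u ≤ pre w := by
  induction h with
  | refl => exact ⟨hw, le_rfl⟩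
  | step hn _ ih =>
    have hlt := lt_of_le_of_ne hw hn
    obtain ⟨h1, h2⟩ := ih (F.par_le _ hlt)
    exact ⟨h1, h2.trans (F.pre_par_lt _ hlt).le⟩

theorem pre_inj (F : Forest n Nb pre par ord) {u w : ℕ} (hu : u ≤ n) (hw : w ≤ n)
    (h : pre u = pre w) : u = w := by
  rw [← F.ord_pre u hu, ← F.ord_pre w hw, h]

theorem not_anc_par (F : Forest n Nb pre par ord) {v : ℕ} (hv : v < n) : ¬ Anc n par v (par v) := by
  intro h
  have := (F.anc_le h (F.par_le v hv)).2
  have := F.pre_par_lt v hv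
  omega

theorem anc_par {n : ℕ} {par : ℕ → ℕ} {v : ℕ} (hv : v < n) : Anc n par (par v) v :=
  Anc.step hv.ne Anc.refl

theorem exists_child (F : Forest n Nb pre par ord) {u w : ℕ} (hw : w ≤ n) (h : Anc n par u w)
    (hne : u ≠ w) : ∃ c ∈ children n par u, Anc n par c w := by
  induction h with
  | refl => exact absurd rfl hne
  | @step w hn h ih =>
    have hlt := lt_of_le_of_ne hw hn
    by_cases hu : u = par w
    · exact ⟨w, mem_children.mpr ⟨hlt, hu.symm⟩, Anc.refl⟩
    · obtain ⟨c, hc, hcw⟩ := ih (F.par_le _ hlt) hu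
      exact ⟨c, hc, Anc.step hn hcw⟩

theorem exists_root (F : Forest n Nb pre par ord) {v : ℕ} (hv : v < n) :
    ∃ r < n, par r = n ∧ Anc n par r v := by
  induction hm : pre v using Nat.strong_induction_on generalizing v with
  | _ m ih =>
    subst hm
    rcases (F.par_le v hv).lt_or_eq with h | h
    · obtain ⟨r, hr, hrn, ha⟩ := ih _ (F.pre_par_lt v hv) h rfl
      exact ⟨r, hr, hrn, ha.trans (anc_par hv)⟩
    · exact ⟨v, hv, h, Anc.refl⟩

/-- Two siblings above a common vertex would be comparable. The lower one being different, the upper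
one would then be an ancestor of their common parent, that is, of its own parent. -/
theorem subtree_disjoint (F : Forest n Nb pre par ord) (v : ℕ) :
    (children n par v : Set ℕ).PairwiseDisjoint (subtree n par) := by
  intro c hc d hd hne
  obtain ⟨hcn, hcv⟩ := mem_children.mp hc
  obtain ⟨hdn, hdv⟩ := mem_children.mp hd
  refine Finset.disjoint_left.mpr fun w hw hw' => ?_
  rw [mem_subtree] at hw hw'
  rcases hw.2.total hw'.2 with h | h
  · have := h.par_of_ne hne
    rw [hdv, ← hcv] at this
    exact F.not_anc_par hcn this
  · have := h.par_of_ne hne.symm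
    rw [hcv, ← hdv] at this
    exact F.not_anc_par hdn this

theorem subtree_eq (F : Forest n Nb pre par ord) {v : ℕ} (hv : v ≤ n) :
    subtree n par v = insert v ((children n par v).biUnion (subtree n par)) := by
  ext w
  simp only [mem_subtree, Finset.mem_insert, Finset.mem_biUnion]
  constructor
  · rintro ⟨hw, ha⟩
    by_cases hne : v = w
    · exact Or.inl hne.symm
    · obtain ⟨c, hc, hcw⟩ := F.exists_child hw ha hne
      exact Or.inr ⟨c, hc, hw, hcw⟩
  · rintro (rfl | ⟨c, hc, hw, hcw⟩)
    · exact ⟨hv, Anc.refl⟩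
    · obtain ⟨hcn, hcv⟩ := mem_children.mp hc
      exact ⟨hw, (hcv ▸ anc_par hcn : Anc n par v c).trans hcw⟩

theorem card_subtree (F : Forest n Nb pre par ord) {v : ℕ} (hv : v ≤ n) :
    (subtree n par v).card = 1 + ∑ c ∈ children n par v, (subtree n par c).card := by
  rw [F.subtree_eq hv, Finset.card_insert_of_notMem, Finset.card_biUnion (F.subtree_disjoint v),
    add_comm]
  simp only [Finset.mem_biUnion, mem_subtree, not_exists, not_and]
  intro c hc _ ha
  obtain ⟨hcn, rfl⟩ := mem_children.mp hc
  exact F.not_anc_par hcn ha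

theorem card_subtree_le (v : ℕ) : (subtree n par v).card ≤ n + 1 := by
  have : subtree n par v ⊆ Finset.range (n + 1) := fun w hw =>
    Finset.mem_range.mpr (Nat.lt_succ_of_le (mem_subtree.mp hw).1)
  simpa using Finset.card_le_card this

/-- This recursion allows low points to be computed from those of the children. -/
theorem escapes_iff (F : Forest n Nb pre par ord) {v k : ℕ} (hv : v ≤ n) :
    Escapes n Nb pre par v k ↔
      (∃ x, Nb v x ∧ pre x < k) ∨ ∃ c ∈ children n par v, Escapes n Nb pre par c k := by
  constructor
  · rintro ⟨w, hw, x, ha, hx⟩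
    by_cases hne : v = w
    · subst hne
      exact Or.inl ⟨x, hx⟩
    · obtain ⟨c, hc, hcw⟩ := F.exists_child hw ha hne
      exact Or.inr ⟨c, hc, w, hw, x, hcw, hx⟩
  · rintro (⟨x, hx⟩ | ⟨c, hc, w, hw, x, ha, hx⟩)
    · exact ⟨v, hv, x, Anc.refl, hx⟩
    · obtain ⟨hcn, hcv⟩ := mem_children.mp hc
      exact ⟨w, hw, x, (hcv ▸ anc_par hcn : Anc n par v c).trans ha, hx⟩

end Forest

/-- The relation `Nb` on `0, …, n` restricts to the adjacency of `G`, and `n` is joined to all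
vertices of `G`. -/
structure Represents {n : ℕ} (G : SimpleGraph (Fin n)) (Nb : ℕ → ℕ → Prop) : Prop where
  adj : ∀ (v : Fin n) (x : ℕ), Nb v x ↔ ∃ w : Fin n, x = w ∧ G.Adj v w
  root : ∀ x, Nb n x ↔ x < n

/-! ### Subtrees as pieces of the graph without a vertex -/

section Impact

variable {n : ℕ} {G : SimpleGraph (Fin n)} {Nb : ℕ → ℕ → Prop} {pre par ord : ℕ → ℕ}

theorem Represents.adj_iff (hG : Represents G Nb) (v w : Fin n) : Nb v w ↔ G.Adj v w := by
  rw [hG.adj]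
  constructor
  · rintro ⟨w', h, ha⟩
    rwa [Fin.ext h]
  · exact fun h => ⟨w, rfl, h⟩

/-- There are no cross edges: the endpoint with the smaller number is an ancestor of the other. -/
theorem Forest.adj_anc (F : Forest n Nb pre par ord) (hG : Represents G Nb) {v w : Fin n}
    (h : G.Adj v w) : Anc n par v w ∨ Anc n par w v := by
  rcases lt_trichotomy (pre v) (pre w) with hlt | heq | hgt
  · exact Or.inl (F.edge v v.2.le w w.2.le ((hG.adj_iff v w).mpr h) hlt)
  · exact absurd (Fin.ext (F.pre_inj v.2.le w.2.le heq)) h.ne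
  · exact Or.inr (F.edge w w.2.le v v.2.le ((hG.adj_iff w v).mpr h.symm) hgt)

theorem Forest.adj_par (F : Forest n Nb pre par ord) (hG : Represents G Nb) {v p : Fin n}
    (h : par v = p) : G.Adj p v := by
  rw [← hG.adj_iff, ← h]
  exact F.nb_par v v.2

/-- A subtree hanging from the root `n` is closed under adjacency. -/
theorem Forest.anc_root_of_adj (F : Forest n Nb pre par ord) (hG : Represents G Nb) {r : ℕ}
    (hr : par r = n) {v w : Fin n} (hv : Anc n par r v) (h : G.Adj v w) : Anc n par r w := by
  rcases F.adj_anc hG h with ha | ha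
  · exact hv.trans ha
  · rcases hv.total ha with h' | h'
    · exact h'
    · by_cases hne : (w : ℕ) = r
      · rw [hne]; exact Anc.refl
      · have := h'.par_of_ne hne
        rw [hr] at this
        exact absurd this.of_root w.2.ne

theorem Forest.anc_root_of_reachable (F : Forest n Nb pre par ord) (hG : Represents G Nb) {r : ℕ}
    (hr : par r = n) {v w : Fin n} (hv : Anc n par r v) (h : G.Reachable v w) :
    Anc n par r w := by
  obtain ⟨p⟩ := h
  induction p with
  | nil => exact hv
  | cons hadj _ ih => exact ih (F.anc_root_of_adj hG hr hv hadj)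

/-- Two vertices in the same subtree are joined by the tree path, which avoids `v` unless `v` lies
on it. -/
theorem Forest.reachable_removeVertex_of_anc (F : Forest n Nb pre par ord) (hG : Represents G Nb)
    {v a w : Fin n} (h : Anc n par a w) (hv : Anc n par a v → ¬ Anc n par v w) :
    ∃ hw ha, (G.removeVertex v).Reachable ⟨w, hw⟩ ⟨a, ha⟩ := by
  obtain ⟨w, hwn⟩ := w
  simp only at h hv
  induction h with
  | refl =>
    have hne : a ≠ v := by
      rintro rfl
      exact hv Anc.refl Anc.refl
    exact ⟨hne, hne, SimpleGraph.Reachable.refl _⟩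
  | @step w hn h ih =>
    have hpn : par w < n := by
      refine lt_of_le_of_ne (F.par_le w hwn) fun e => ?_
      rw [e] at h
      exact a.2.ne h.of_root
    obtain ⟨hp, ha, hr⟩ := ih hpn fun h1 h2 => hv h1 (h2.trans (anc_par hwn))
    have hne : (⟨w, hwn⟩ : Fin n) ≠ v := by
      rintro rfl
      exact hv (Anc.step hn h) Anc.refl
    have hadj : (G.removeVertex v).Adj ⟨⟨w, hwn⟩, hne⟩ ⟨⟨par w, hpn⟩, hp⟩ :=
      (F.adj_par hG (v := ⟨w, hwn⟩) (p := ⟨par w, hpn⟩) rfl).symm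
    exact ⟨hne, ha, hadj.reachable.trans hr⟩

theorem Forest.reachable_of_anc (F : Forest n Nb pre par ord) (hG : Represents G Nb)
    {a w : Fin n} (h : Anc n par a w) : G.Reachable a w := by
  obtain ⟨w, hwn⟩ := w
  simp only at h
  induction h with
  | refl => exact SimpleGraph.Reachable.refl _
  | @step w hn h ih =>
    have hpn : par w < n := by
      refine lt_of_le_of_ne (F.par_le w hwn) fun e => ?_
      rw [e] at h
      exact a.2.ne h.of_root
    exact (ih hpn).trans (F.adj_par hG (v := ⟨w, hwn⟩) (p := ⟨par w, hpn⟩) rfl).reachable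

theorem ncard_fin_eq_card {n : ℕ} (s : Finset ℕ) (hs : ∀ w ∈ s, w < n) :
    {w : Fin n | (w : ℕ) ∈ s}.ncard = s.card := by
  rw [← Set.ncard_image_of_injective _ Fin.val_injective, ← Set.ncard_coe_finset s]
  congr 1
  ext w
  constructor
  · rintro ⟨x, hx, rfl⟩
    exact hx
  · intro hw
    exact ⟨⟨w, hs w hw⟩, hw, rfl⟩

theorem lt_of_mem_subtree {v w : ℕ} (hv : v < n) (h : w ∈ subtree n par v) : w < n := by
  rw [mem_subtree] at h
  refine lt_of_le_of_ne h.1 ?_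
  rintro rfl
  exact hv.ne h.2.of_root

/-- The size of the connected component of `v`. -/
noncomputable def componentSize (G : SimpleGraph (Fin n)) (v : Fin n) : ℕ :=
  {w | G.Reachable v w}.ncard

theorem componentSize_congr {v w : Fin n} (h : G.Reachable v w) :
    componentSize G v = componentSize G w := by
  unfold componentSize
  congr 1
  ext x
  exact ⟨fun h' => h.symm.trans h', fun h' => h.trans h'⟩

theorem componentSize_le (v : Fin n) : componentSize G v ≤ n := by
  refine (Set.ncard_le_ncard (Set.subset_univ _)).trans ?_
  simp [Set.ncard_univ]

theorem ncard_otherReachable (v : Fin n) :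
    (G.otherReachable v).ncard = componentSize G v - 1 := by
  have : G.otherReachable v = {w | G.Reachable v w} \ {v} := by
    ext w
    exact and_comm
  rw [this, Set.ncard_sdiff_singleton_of_mem (show v ∈ {w | G.Reachable v w} from .refl v)]
  rfl

/-- The trees hanging from `n` are the components of `G`: tree paths connect them, and no edge
leaves them. -/
theorem Forest.card_subtree_root (F : Forest n Nb pre par ord) (hG : Represents G Nb) {v : Fin n}
    (hv : par v = n) : (subtree n par v).card = componentSize G v := by
  rw [← ncard_fin_eq_card _ fun w => lt_of_mem_subtree v.2]
  unfold componentSize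
  congr 1
  ext w
  simp only [Set.mem_ofPred_eq, mem_subtree]
  exact ⟨fun h => F.reachable_of_anc hG h.2,
    fun h => ⟨w.2.le, F.anc_root_of_reachable hG hv Anc.refl h⟩⟩

/-- The subtree below a cut child of `v` is closed under adjacency in the graph without `v`. -/
theorem Forest.anc_cutChild_of_adj (F : Forest n Nb pre par ord) (hG : Represents G Nb)
    {v x y : Fin n} {c : ℕ} (hc : c ∈ cutChildren n Nb pre par v) (hx : Anc n par c x)
    (hy : y ≠ v) (h : G.Adj x y) : Anc n par c y := by
  obtain ⟨⟨hcn, hcv⟩, hesc⟩ := mem_cutChildren.mp hc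
  rcases F.adj_anc hG h with ha | ha
  · exact hx.trans ha
  · rcases hx.total ha with h' | h'
    · exact h'
    · by_cases hne : (y : ℕ) = c
      · rw [hne]; exact Anc.refl
      · have h1 := h'.par_of_ne hne
        rw [hcv] at h1
        -- Here `y` is an ancestor of `c` other than `c` itself, hence an ancestor of `v`. As `y ≠
        -- v`, its number is below `pre v`, so the edge from `x` to `y` would be an escape.
        refine absurd ⟨x, x.2.le, y, hx, (hG.adj_iff x y).mpr h, ?_⟩ hesc
        refine lt_of_le_of_ne (F.anc_le h1 v.2.le).2 fun e => hy ?_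
        exact Fin.ext (F.pre_inj y.2.le v.2.le e)

/-- The vertices below the cut children of `v`. -/
def cutOff (n : ℕ) (Nb : ℕ → ℕ → Prop) (pre par : ℕ → ℕ) (v : Fin n) : Set (Fin n) :=
  {w | ∃ c ∈ cutChildren n Nb pre par v, Anc n par c w}

theorem Forest.anc_of_cutChild {v : Fin n} {c : ℕ}
    (hc : c ∈ cutChildren n Nb pre par v) : Anc n par v c := by
  obtain ⟨⟨hcn, hcv⟩, -⟩ := mem_cutChildren.mp hc
  exact hcv ▸ anc_par hcn

theorem Forest.ne_of_anc_child (F : Forest n Nb pre par ord) {v w : Fin n} {c : ℕ} (hcn : c < n)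
    (hcv : par c = v) (h : Anc n par c w) : w ≠ v := by
  rintro rfl
  rw [← hcv] at h
  exact F.not_anc_par hcn h

theorem Forest.cutOff_subset (F : Forest n Nb pre par ord) (hG : Represents G Nb) (v : Fin n) :
    cutOff n Nb pre par v ⊆ G.otherReachable v := by
  rintro w ⟨c, hc, hcw⟩
  obtain ⟨⟨hcn, hcv⟩, -⟩ := mem_cutChildren.mp hc
  exact ⟨F.ne_of_anc_child hcn hcv hcw, F.reachable_of_anc hG ((anc_of_cutChild hc).trans hcw)⟩

theorem Forest.ncard_cutOff (F : Forest n Nb pre par ord) (v : Fin n) :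
    (cutOff n Nb pre par v).ncard =
      ∑ c ∈ cutChildren n Nb pre par v, (subtree n par c).card := by
  have hsub : cutChildren n Nb pre par v ⊆ children n par v := by
    intro c hc
    exact mem_children.mpr (mem_cutChildren.mp hc).1
  rw [← Finset.card_biUnion fun c hc d hd => F.subtree_disjoint v (hsub hc) (hsub hd),
    ← ncard_fin_eq_card]
  · congr 1
    ext w
    simp [cutOff, mem_subtree]
  · intro w hw
    obtain ⟨c, hc, hw⟩ := Finset.mem_biUnion.mp hw
    exact lt_of_mem_subtree (mem_cutChildren.mp hc).1.1 hw

/-- The vertices of the component of `v` that are not below a cut child stay connected. -/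
theorem Forest.rest_connected (F : Forest n Nb pre par ord) (hG : Represents G Nb) (v : Fin n) :
    ∀ a ∈ G.otherReachable v \ cutOff n Nb pre par v,
    ∀ b ∈ G.otherReachable v \ cutOff n Nb pre par v,
      ∃ ha hb, (G.removeVertex v).Reachable ⟨a, ha⟩ ⟨b, hb⟩ := by
  -- The root `r` of the tree of `v` serves as the meeting point of the rest. If `v = r`, the rest
  -- is empty.
  obtain ⟨r, hrn, hr, hrv⟩ := F.exists_root v.2
  suffices key : ∀ a ∈ G.otherReachable v \ cutOff n Nb pre par v,
      ∃ ha hb, (G.removeVertex v).Reachable ⟨a, ha⟩ ⟨⟨r, hrn⟩, hb⟩ by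
    intro a ha b hb
    obtain ⟨ha', _, h1⟩ := key a ha
    obtain ⟨hb', _, h2⟩ := key b hb
    exact ⟨ha', hb', h1.trans h2.symm⟩
  have outside : ∀ a : Fin n, G.Reachable v a → ¬ Anc n par v a →
      ∃ ha hb, (G.removeVertex v).Reachable ⟨a, ha⟩ ⟨⟨r, hrn⟩, hb⟩ := fun a h1 h2 =>
    F.reachable_removeVertex_of_anc hG (a := ⟨r, hrn⟩)
      (F.anc_root_of_reachable hG hr hrv h1) fun _ => h2
  rintro a ⟨⟨hav, hreach⟩, hcut⟩
  by_cases hva : Anc n par v a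
  · obtain ⟨c, hc, hca⟩ := F.exists_child a.2.le hva fun e => hav (Fin.ext e.symm)
    obtain ⟨hcn, hcv⟩ := mem_children.mp hc
    have hesc : Escapes n Nb pre par c (pre v) := by
      by_contra hesc
      exact hcut ⟨c, mem_cutChildren.mpr ⟨⟨hcn, hcv⟩, hesc⟩, hca⟩
    -- The detour around `v`: from `a` to `w` through the subtree of `c`, across the escaping edge
    -- to `x`, and from there up to `r`. By its number, `x` is not below `v`.
    obtain ⟨w, hwn, x, hcw, hwx, hx⟩ := hesc
    have hwlt : w < n := lt_of_mem_subtree hcn (mem_subtree.mpr ⟨hwn, hcw⟩)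
    obtain ⟨x, rfl, hadj⟩ := (hG.adj ⟨w, hwlt⟩ x).mp hwx
    have hinside : ∀ b : Fin n, Anc n par c b →
        ∃ hb hc, (G.removeVertex v).Reachable ⟨b, hb⟩ ⟨⟨c, hcn⟩, hc⟩ := fun b hb =>
      F.reachable_removeVertex_of_anc hG (a := ⟨c, hcn⟩) hb fun h =>
        absurd (hcv ▸ h) (F.not_anc_par hcn)
    have hvw : Anc n par v w := (hcv ▸ anc_par hcn : Anc n par v c).trans hcw
    have hvx : ¬ Anc n par v x := fun h => by
      have := (F.anc_le h x.2.le).2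
      omega
    obtain ⟨hx', hr', h1⟩ := outside x
      ((F.reachable_of_anc hG (w := ⟨w, hwlt⟩) hvw).trans hadj.reachable) hvx
    obtain ⟨ha', _, h2⟩ := hinside a hca
    obtain ⟨hw', _, h3⟩ := hinside ⟨w, hwlt⟩ hcw
    have h4 : (G.removeVertex v).Adj ⟨⟨w, hwlt⟩, hw'⟩ ⟨x, hx'⟩ := hadj
    exact ⟨ha', hr', (h2.trans h3.symm).trans (h4.reachable.trans h1)⟩
  · exact outside a hreach hva

/-- The size of a largest component that survives the removal of `v`. -/
theorem Forest.sSup_survivingSizes (F : Forest n Nb pre par ord) (hG : Represents G Nb)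
    (v : Fin n) :
    sSup (G.survivingSizes v) =
      max (componentSize G v - 1 - ∑ c ∈ cutChildren n Nb pre par v, (subtree n par c).card)
        ((cutChildren n Nb pre par v).sup fun c => (subtree n par c).card) := by
  have hrest : (G.otherReachable v \ cutOff n Nb pre par v).ncard =
      componentSize G v - 1 - ∑ c ∈ cutChildren n Nb pre par v, (subtree n par c).card := by
    rw [Set.ncard_sdiff (F.cutOff_subset hG v), ncard_otherReachable, F.ncard_cutOff]
  have hcard : ∀ c < n, {w : Fin n | Anc n par c w}.ncard = (subtree n par c).card := by
    intro c hc
    rw [← ncard_fin_eq_card _ fun w => lt_of_mem_subtree hc]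
    congr 1
    ext w
    simp [mem_subtree]
  apply le_antisymm
  · apply SimpleGraph.sSup_survivingSizes_le
    intro w hw
    -- Each cut subtree and the rest are closed under adjacency away from `v`, so together they
    -- bound every surviving component.
    by_cases hcut : w ∈ cutOff n Nb pre par v
    · obtain ⟨c, hc, hcw⟩ := hcut
      refine ⟨{w : Fin n | Anc n par c w}, hcw, ?_, ?_⟩
      · rw [hcard c (mem_cutChildren.mp hc).1.1]
        exact le_max_of_le_right
          (Finset.le_sup (f := fun c => (subtree n par c).card) hc)
      · exact fun x hx y hy h => F.anc_cutChild_of_adj hG hc hx hy h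
    · refine ⟨G.otherReachable v \ cutOff n Nb pre par v, ⟨hw, hcut⟩, ?_, ?_⟩
      · rw [hrest]
        exact le_max_left _ _
      · rintro x ⟨hx, hxc⟩ y hy h
        refine ⟨⟨hy, hx.2.trans h.reachable⟩, ?_⟩
        rintro ⟨c, hc, hcy⟩
        exact hxc ⟨c, hc, F.anc_cutChild_of_adj hG hc hcy hx.1 h.symm⟩
  · apply max_le
    · rw [← hrest]
      exact SimpleGraph.le_sSup_survivingSizes Set.sdiff_subset (F.rest_connected hG v)
    · refine Finset.sup_le fun c hc => ?_
      obtain ⟨⟨hcn, hcv⟩, -⟩ := mem_cutChildren.mp hc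
      rw [← hcard c hcn]
      refine SimpleGraph.le_sSup_survivingSizes
        (fun w hw => F.cutOff_subset hG v ⟨c, hc, hw⟩) ?_
      have key : ∀ a : Fin n, Anc n par c a →
          ∃ ha hb, (G.removeVertex v).Reachable ⟨a, ha⟩ ⟨⟨c, hcn⟩, hb⟩ := fun a ha =>
        F.reachable_removeVertex_of_anc hG (a := ⟨c, hcn⟩) ha fun h =>
          absurd (hcv ▸ h) (F.not_anc_par hcn)
      intro a ha b hb
      obtain ⟨ha', _, h1⟩ := key a ha
      obtain ⟨hb', _, h2⟩ := key b hb
      exact ⟨ha', hb', h1.trans h2.symm⟩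

theorem Forest.impact_eq (F : Forest n Nb pre par ord) (hG : Represents G Nb) (v : Fin n) :
    G.impact v = componentSize G v - 1 -
      max (componentSize G v - 1 - ∑ c ∈ cutChildren n Nb pre par v, (subtree n par c).card)
        ((cutChildren n Nb pre par v).sup fun c => (subtree n par c).card) := by
  rw [← F.sSup_survivingSizes hG v, ← ncard_otherReachable]
  rfl

end Impact

end DepthFirst

/-! ### Accumulation over the forest, children before parents -/

namespace DepthFirst

/-- The data of every vertex, accumulated over those children whose number exceeds `i`. -/
structure Accumulated (n : ℕ) (Nb : ℕ → ℕ → Prop) (pre par : ℕ → ℕ) (i : ℕ)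
    (size low sum mx : ℕ → ℕ) : Prop where
  size : ∀ v ≤ n, size v =
    1 + ∑ c ∈ (children n par v).filter (fun c => i < pre c), (subtree n par c).card
  low : ∀ v ≤ n, ∀ k ≤ pre v, (low v < k ↔
    (∃ x, Nb v x ∧ pre x < k) ∨ ∃ c ∈ children n par v, i < pre c ∧ Escapes n Nb pre par c k)
  sum : ∀ v ≤ n, sum v =
    ∑ c ∈ (cutChildren n Nb pre par v).filter (fun c => i < pre c), (subtree n par c).card
  mx : ∀ v ≤ n, mx v =
    ((cutChildren n Nb pre par v).filter (fun c => i < pre c)).sup fun c => (subtree n par c).card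

namespace Accumulated

variable {n : ℕ} {Nb : ℕ → ℕ → Prop} {pre par ord : ℕ → ℕ} {i : ℕ} {size low sum mx : ℕ → ℕ}

theorem cutChildren_subset (v : ℕ) : cutChildren n Nb pre par v ⊆ children n par v :=
  fun _ hc => mem_children.mpr (mem_cutChildren.mp hc).1

theorem size_le (h : Accumulated n Nb pre par i size low sum mx) (F : Forest n Nb pre par ord)
    {v : ℕ} (hv : v ≤ n) : size v ≤ n + 1 := by
  refine le_trans ?_ (Forest.card_subtree_le (n := n) (par := par) v)
  rw [h.size v hv, F.card_subtree hv]
  exact Nat.add_le_add_left (Finset.sum_le_sum_of_subset (Finset.filter_subset _ _)) 1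

theorem sum_le (h : Accumulated n Nb pre par i size low sum mx) (F : Forest n Nb pre par ord)
    {v : ℕ} (hv : v ≤ n) : sum v ≤ n + 1 := by
  refine le_trans ?_ (h.size_le F hv)
  rw [h.size v hv, h.sum v hv]
  refine le_trans ?_ (Nat.le_add_left _ 1)
  exact Finset.sum_le_sum_of_subset (Finset.filter_subset_filter _ (cutChildren_subset v))

theorem child_lt (F : Forest n Nb pre par ord) {v c : ℕ} (hc : c ∈ children n par v) :
    pre v < pre c := by
  obtain ⟨hcn, rfl⟩ := mem_children.mp hc
  exact F.pre_par_lt c hcn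

/-- Children have larger numbers than their parent, so once `i ≤ pre v` the filter excludes no child
and the data of `v` are final. The same holds for the next three lemmas. -/
theorem size_eq (h : Accumulated n Nb pre par i size low sum mx) (F : Forest n Nb pre par ord)
    {v : ℕ} (hv : v ≤ n) (hi : i ≤ pre v) : size v = (subtree n par v).card := by
  rw [h.size v hv, F.card_subtree hv, Finset.filter_true_of_mem]
  exact fun c hc => hi.trans_lt (child_lt F hc)

theorem low_lt_iff (h : Accumulated n Nb pre par i size low sum mx) (F : Forest n Nb pre par ord)
    {v : ℕ} (hv : v ≤ n) (hi : i ≤ pre v) {k : ℕ} (hk : k ≤ pre v) :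
    low v < k ↔ Escapes n Nb pre par v k := by
  rw [h.low v hv k hk, F.escapes_iff hv]
  refine or_congr_right (exists_congr fun c => and_congr_right fun hc => ?_)
  exact and_iff_right (hi.trans_lt (child_lt F hc))

theorem sum_eq (h : Accumulated n Nb pre par i size low sum mx) (F : Forest n Nb pre par ord)
    {v : ℕ} (hv : v ≤ n) (hi : i ≤ pre v) :
    sum v = ∑ c ∈ cutChildren n Nb pre par v, (subtree n par c).card := by
  rw [h.sum v hv, Finset.filter_true_of_mem]
  exact fun c hc => hi.trans_lt (child_lt F (cutChildren_subset v hc))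

theorem mx_eq (h : Accumulated n Nb pre par i size low sum mx) (F : Forest n Nb pre par ord)
    {v : ℕ} (hv : v ≤ n) (hi : i ≤ pre v) :
    mx v = (cutChildren n Nb pre par v).sup fun c => (subtree n par c).card := by
  rw [h.mx v hv, Finset.filter_true_of_mem]
  exact fun c hc => hi.trans_lt (child_lt F (cutChildren_subset v hc))

/-- The state before the first vertex is processed. -/
theorem start (F : Forest n Nb pre par ord)
    (hlow : ∀ v ≤ n, ∀ k ≤ pre v, (low v < k ↔ ∃ x, Nb v x ∧ pre x < k))
    (hsize : ∀ v ≤ n, size v = 1) (hsum : ∀ v ≤ n, sum v = 0) (hmx : ∀ v ≤ n, mx v = 0) :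
    Accumulated n Nb pre par (n + 1) size low sum mx := by
  have hno : ∀ c < n, ¬ n + 1 < pre c := fun c hc => (F.pre_le c hc.le).not_gt
  have hempty : ∀ v, (children n par v).filter (fun c => n + 1 < pre c) = ∅ := fun v =>
    Finset.filter_false_of_mem fun c hc => hno c (mem_children.mp hc).1
  have hempty' : ∀ v, (cutChildren n Nb pre par v).filter (fun c => n + 1 < pre c) = ∅ := fun v =>
    Finset.filter_false_of_mem fun c hc => hno c (mem_cutChildren.mp hc).1.1
  refine ⟨fun v hv => ?_, fun v hv k hk => ?_, fun v hv => ?_, fun v hv => ?_⟩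
  · rw [hempty, hsize v hv, Finset.sum_empty, add_zero]
  · rw [hlow v hv k hk]
    refine (or_iff_left ?_).symm
    rintro ⟨c, hc, hlt, -⟩
    exact hno c (mem_children.mp hc).1 hlt
  · rw [hempty', hsum v hv, Finset.sum_empty]
  · rw [hempty', hmx v hv, Finset.sup_empty]
    rfl

/-- One vertex is added to the data of its parent. -/
theorem step (h : Accumulated n Nb pre par (i + 1) size low sum mx) (F : Forest n Nb pre par ord)
    {v p : ℕ} (hv : v < n) (hi : pre v = i + 1) (hp : par v = p) :
    Accumulated n Nb pre par i (Function.update size p (size p + size v))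
      (Function.update low p (min (low p) (low v)))
      (if low v < pre p then sum else Function.update sum p (sum p + size v))
      (if low v < pre p then mx else Function.update mx p (max (mx p) (size v))) := by
  subst hp
  have hsz := h.size_eq F hv.le hi.ge
  have hlow := fun k => h.low_lt_iff F hv.le hi.ge (k := k)
  have hpn := F.par_le v hv
  have hplt := F.pre_par_lt v hv
  -- Numbers are distinct, so lowering the threshold from `i + 1` to `i` admits exactly the vertex
  -- `v`.
  have hnew : ∀ c < n, (i < pre c ↔ c = v ∨ i + 1 < pre c) := by
    intro c hc
    constructor
    · intro hlt
      rcases Nat.lt_or_eq_of_le (Nat.succ_le_of_lt hlt) with h1 | h1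
      · exact Or.inr h1
      · exact Or.inl (F.pre_inj hc.le hv.le (by rw [hi, ← h1]))
    · rintro (rfl | h1) <;> omega
  have hold : ∀ (s : Finset ℕ), (∀ c ∈ s, c < n) → v ∉ s →
      s.filter (fun c => i < pre c) = s.filter (fun c => i + 1 < pre c) := by
    intro s hs hvs
    refine Finset.filter_congr fun c hc => ?_
    rw [hnew c (hs c hc), or_iff_right]
    rintro rfl
    exact hvs hc
  have hins : ∀ (s : Finset ℕ), (∀ c ∈ s, c < n) → v ∈ s →
      s.filter (fun c => i < pre c) = insert v (s.filter (fun c => i + 1 < pre c)) := by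
    intro s hs hvs
    ext c
    simp only [Finset.mem_filter, Finset.mem_insert]
    constructor
    · rintro ⟨hc, hlt⟩
      rcases (hnew c (hs c hc)).mp hlt with rfl | h1
      · exact Or.inl rfl
      · exact Or.inr ⟨hc, h1⟩
    · rintro (rfl | ⟨hc, hlt⟩)
      · exact ⟨hvs, by omega⟩
      · exact ⟨hc, by omega⟩
  have hnotin : ∀ s : Finset ℕ, v ∉ s.filter (fun c => i + 1 < pre c) := by
    intro s hs
    have := (Finset.mem_filter.mp hs).2
    omega
  have hch : ∀ u, ∀ c ∈ children n par u, c < n := fun u c hc => (mem_children.mp hc).1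
  have hcut : ∀ u, ∀ c ∈ cutChildren n Nb pre par u, c < n :=
    fun u c hc => (mem_cutChildren.mp hc).1.1
  have hmem : ∀ u, v ∈ children n par u ↔ u = par v := fun u => by
    rw [mem_children, and_iff_right hv, eq_comm]
  -- The low point of `v` is final and its parent's number is below `pre v`, so the comparison made
  -- by the program decides whether `v` is a cut child.
  have hmem' : ∀ u, v ∈ cutChildren n Nb pre par u ↔ u = par v ∧ ¬ low v < pre (par v) := by
    intro u
    rw [mem_cutChildren, and_iff_right hv, hlow _ hplt.le]
    constructor
    · rintro ⟨rfl, h2⟩; exact ⟨rfl, h2⟩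
    · rintro ⟨rfl, h2⟩; exact ⟨rfl, h2⟩
  refine ⟨fun u hu => ?_, fun u hu k hk => ?_, fun u hu => ?_, fun u hu => ?_⟩
  · by_cases e : u = par v
    · subst e
      rw [Function.update_self, hins _ (hch _) ((hmem _).mpr rfl),
        Finset.sum_insert (hnotin _), h.size _ hu, hsz]
      omega
    · rw [Function.update_of_ne e, hold _ (hch _) (fun h' => e ((hmem _).mp h')), h.size _ hu]
  · by_cases e : u = par v
    · subst e
      rw [Function.update_self, min_lt_iff, h.low _ hu k hk, hlow k (hk.trans hplt.le), or_assoc]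
      refine or_congr_right ?_
      constructor
      · rintro (⟨c, hc, hlt, he⟩ | he)
        · exact ⟨c, hc, by omega, he⟩
        · exact ⟨v, (hmem _).mpr rfl, by omega, he⟩
      · rintro ⟨c, hc, hlt, he⟩
        rcases (hnew c (hch _ c hc)).mp hlt with rfl | h1
        · exact Or.inr he
        · exact Or.inl ⟨c, hc, h1, he⟩
    · rw [Function.update_of_ne e, h.low _ hu k hk]
      refine or_congr_right (exists_congr fun c => and_congr_right fun hc => ?_)
      rw [hnew c (hch _ c hc), or_iff_right]
      rintro rfl
      exact e ((hmem _).mp hc)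
  · by_cases e : u = par v ∧ ¬ low v < pre (par v)
    · have hc := (hmem' u).mpr e
      obtain ⟨rfl, hlt⟩ := e
      rw [if_neg hlt, Function.update_self, hins _ (hcut _) hc,
        Finset.sum_insert (hnotin _), h.sum _ hu, hsz, add_comm]
    · rw [hold _ (hcut _) (fun h' => e ((hmem' _).mp h')), ← h.sum _ hu]
      split_ifs with hlt
      · rfl
      · rw [Function.update_of_ne fun e' => e ⟨e', hlt⟩]
  · by_cases e : u = par v ∧ ¬ low v < pre (par v)
    · have hc := (hmem' u).mpr e
      obtain ⟨rfl, hlt⟩ := e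
      rw [if_neg hlt, Function.update_self, hins _ (hcut _) hc,
        Finset.sup_insert, h.mx _ hu, hsz]
      exact max_comm _ _
    · rw [hold _ (hcut _) (fun h' => e ((hmem' _).mp h')), ← h.mx _ hu]
      split_ifs with hlt
      · rfl
      · rw [Function.update_of_ne fun e' => e ⟨e', hlt⟩]

end Accumulated

end DepthFirst

/-! ### The encoding of the input -/

namespace RAM

theorem getElem?_flatten_sum {α : Type*} (L : List (List α)) (k j : ℕ) (hk : k < L.length)
    (hj : j < L[k].length) :
    L.flatten[((L.take k).map List.length).sum + j]? = some L[k][j] := by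
  induction L generalizing k with
  | nil => simp at hk
  | cons l L ih =>
    cases k with
    | zero =>
      simp only [List.getElem_cons_zero] at hj
      simp [List.getElem?_append_left hj]
    | succ k =>
      simp only [List.getElem_cons_succ] at hj
      have e : (((l :: L).take (k + 1)).map List.length).sum + j - l.length =
          ((L.take k).map List.length).sum + j := by
        simp
        omega
      rw [List.flatten_cons, List.getElem?_append_right (by simp; omega), e]
      exact ih k _ hj

variable {n : ℕ} (adj : Fin n → List (Fin n))

theorem listStart_zero : listStart adj 0 = n + 2 := by
  simp [listStart]

theorem listStart_succ (v : Fin n) :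
    listStart adj (v + 1) = listStart adj v + (adj v).length := by
  simp only [listStart]
  rw [List.take_add_one]
  simp
  omega

theorem listStart_mono {j k : ℕ} (h : j ≤ k) : listStart adj j ≤ listStart adj k := by
  unfold listStart
  refine Nat.add_le_add_left ?_ _
  refine List.Sublist.sum_le_sum ?_ (by simp)
  exact (List.take_sublist_take_left h).map _

theorem length_encode : (encode adj).length = listStart adj n := by
  have : (List.ofFn adj).take n = List.ofFn adj := List.take_of_length_le (by simp)
  simp only [encode, listStart, this, List.length_cons, List.length_append, List.length_map,
    List.length_range, List.length_flatten]
  omega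

theorem init_mem_zero : (init adj).mem 0 = n := rfl

theorem init_mem_start {k : ℕ} (hk : k ≤ n) : (init adj).mem (k + 1) = listStart adj k := by
  simp only [init, encode, List.getD_cons_succ]
  rw [List.getD_append _ _ _ _ (by simp; omega)]
  simp [List.getD_eq_getElem?_getD, List.getElem?_range (show k < n + 1 by omega)]

theorem init_mem_entry (v : Fin n) {j : ℕ} (hj : j < (adj v).length) :
    (init adj).mem (listStart adj v + j) = ((adj v)[j] : Fin n) := by
  have hlist := getElem?_flatten_sum (List.ofFn adj) v j (by simp) (by simpa using hj)
  have e : listStart adj v + j =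
      n + 1 + (((List.ofFn adj).take v).map List.length).sum + j + 1 := by
    simp only [listStart]
    omega
  rw [e]
  simp only [init, encode, List.getD_cons_succ]
  rw [List.getD_append_right _ _ _ _ (by simp; omega), List.getD_eq_getElem?_getD]
  have e' : n + 1 + (((List.ofFn adj).take v).map List.length).sum + j -
      ((List.range (n + 1)).map (listStart adj)).length =
      (((List.ofFn adj).take v).map List.length).sum + j := by
    simp
    omega
  rw [e', List.getElem?_map, hlist]
  simp

/-- Needed for the arrays, which start beyond the input and are assumed to be `0` initially. -/
theorem init_mem_end {a : ℕ} (ha : listStart adj n ≤ a) : (init adj).mem a = 0 := by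
  simp only [init]
  rw [List.getD_eq_default]
  rwa [length_encode]

theorem init_mem_le (a : ℕ) : (init adj).mem a ≤ listStart adj n := by
  simp only [init]
  rw [List.getD_eq_getElem?_getD]
  cases h : (encode adj)[a]? with
  | none => simp
  | some x =>
    have hx := List.mem_of_getElem? h
    simp only [Option.getD_some]
    have hn : n ≤ listStart adj n := by unfold listStart; omega
    simp only [encode, List.mem_cons, List.mem_append, List.mem_map, List.mem_range] at hx
    rcases hx with rfl | ⟨k, hk, rfl⟩ | ⟨y, _, rfl⟩
    · exact hn
    · exact listStart_mono adj (by omega)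
    · exact y.2.le.trans hn

/-- Handshake lemma: the lengths of the lists are the degrees. -/
theorem listStart_end {G : SimpleGraph (Fin n)} (h : G.IsAdjacencyList adj) :
    listStart adj n = n + 2 + 2 * G.edgeSet.ncard := by
  classical
  have htake : (List.ofFn adj).take n = List.ofFn adj := List.take_of_length_le (by simp)
  have hdeg : ∀ v, (adj v).length = G.degree v := by
    intro v
    rw [← List.toFinset_card_of_nodup (h v).1, ← SimpleGraph.card_neighborFinset_eq_degree]
    congr 1
    ext u
    simp [(h v).2 u]
  have hedge : G.edgeSet.ncard = G.edgeFinset.card := by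
    rw [← SimpleGraph.coe_edgeFinset, Set.ncard_coe_finset]
  rw [hedge, ← G.sum_degrees_eq_twice_card_edges, listStart, htake, List.map_ofFn, List.sum_ofFn]
  simp [hdeg]

end RAM

/-! ### The program -/

namespace RAM

namespace ImpactProgram

/-! Variables: `0` is `n`, `1` the end `E` of the input, `2` a loop counter, `3` the current vertex
of the search, `4` the number of visited vertices, `5` to `8` are auxiliary. Arrays: `0` holds the
positions of the search in the lists, `1` their limits, `2` the numbers of the vertices, `3` their
parents, `4` the vertices in the order of their numbers, `5` the low points, `6` the subtree sizes,
`7` and `8` the sum and the maximum of the sizes of the subtrees that are cut off, `9` the component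
sizes. -/

/-- Reads the size of the input. -/
def setup : ArrayProg :=
  .seq (.assign 0 (.raw (.lit 0))) <|
  .assign 1 (.raw (.add (.var 0) (.lit 1)))

/-- The loop condition of the initialization. -/
def fillCond : ArrayExpr := .lt (.var 2) (.var 0)

/-- Initializes the arrays and appends the list of the artificial root to the input. -/
def fillBody : ArrayProg :=
  .seq (.put 0 (.var 2) (.raw (.add (.var 2) (.lit 1)))) <|
  .seq (.put 1 (.var 2) (.add (.raw (.add (.var 2) (.lit 2))) (.lit 1))) <|
  .seq (.put 5 (.var 2) (.add (.var 0) (.lit 2))) <|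
  .seq (.put 6 (.var 2) (.lit 1)) <|
  .seq (.putRaw (.add (.var 1) (.var 2)) (.var 2)) <|
  .assign 2 (.add (.var 2) (.lit 1))

/-- Starts the search at the artificial root. -/
def rootSetup : ArrayProg :=
  .seq (.put 0 (.var 0) (.var 1)) <|
  .seq (.put 1 (.var 0) (.add (.add (.var 1) (.var 0)) (.lit 1))) <|
  .seq (.put 5 (.var 0) (.add (.var 0) (.lit 2))) <|
  .seq (.put 6 (.var 0) (.lit 1)) <|
  .seq (.put 2 (.var 0) (.lit 1)) <|
  .seq (.put 3 (.var 0) (.var 0)) <|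
  .seq (.put 4 (.lit 1) (.var 0)) <|
  .seq (.assign 3 (.var 0)) <|
  .assign 4 (.lit 1)

/-- The loop condition of the search. -/
def searchCond : ArrayExpr := .lt (.get 0 (.var 3)) (.get 1 (.var 3))

/-- One step of the depth-first search. -/
def searchBody : ArrayProg :=
  .seq (.assign 5 (.get 0 (.var 3))) <|
  .seq (.put 0 (.var 3) (.add (.var 5) (.lit 1))) <|
  .ite (.lt (.add (.var 5) (.lit 1)) (.get 1 (.var 3)))
    (.seq (.assign 6 (.raw (.var 5))) <|
      .ite (.get 2 (.var 6))
        (.ite (.lt (.get 2 (.var 6)) (.get 5 (.var 3)))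
          (.put 5 (.var 3) (.get 2 (.var 6))) .skip)
        (.seq (.assign 4 (.add (.var 4) (.lit 1))) <|
          .seq (.put 2 (.var 6) (.var 4)) <|
          .seq (.put 3 (.var 6) (.var 3)) <|
          .seq (.put 4 (.var 4) (.var 6)) <|
          .assign 3 (.var 6)))
    (.assign 3 (.get 3 (.var 3)))

/-- Prepares the pass over the vertices in decreasing order of their numbers. -/
def collectSetup : ArrayProg := .assign 2 (.add (.var 0) (.lit 1))

/-- The loop condition of this pass. -/
def collectCond : ArrayExpr := .lt (.lit 1) (.var 2)

/-- Adds the data of a vertex to those of its parent. -/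
def collectBody : ArrayProg :=
  .seq (.assign 6 (.get 4 (.var 2))) <|
  .seq (.assign 5 (.get 3 (.var 6))) <|
  .seq (.assign 2 (.sub (.var 2) (.lit 1))) <|
  .seq (.ite (.lt (.get 5 (.var 6)) (.get 2 (.var 5))) .skip
    (.seq (.put 7 (.var 5) (.add (.get 7 (.var 5)) (.get 6 (.var 6)))) <|
      .ite (.lt (.get 8 (.var 5)) (.get 6 (.var 6))) (.put 8 (.var 5) (.get 6 (.var 6))) .skip)) <|
  .seq (.put 6 (.var 5) (.add (.get 6 (.var 5)) (.get 6 (.var 6)))) <|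
  .ite (.lt (.get 5 (.var 6)) (.get 5 (.var 5))) (.put 5 (.var 5) (.get 5 (.var 6))) .skip

/-- Prepares the pass over the vertices in increasing order of their numbers. -/
def outputSetup : ArrayProg := .assign 2 (.lit 2)

/-- The loop condition of this pass. -/
def outputCond : ArrayExpr := .lt (.var 2) (.add (.var 0) (.lit 2))

/-- Computes and writes the impact of a vertex. -/
def outputBody : ArrayProg :=
  .seq (.assign 6 (.get 4 (.var 2))) <|
  .seq (.assign 5 (.get 3 (.var 6))) <|
  .seq (.assign 2 (.add (.var 2) (.lit 1))) <|
  .seq (.ite (.eq (.var 5) (.var 0)) (.assign 7 (.get 6 (.var 6))) (.assign 7 (.get 9 (.var 5)))) <|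
  .seq (.put 9 (.var 6) (.var 7)) <|
  .seq (.assign 7 (.sub (.var 7) (.lit 1))) <|
  .seq (.assign 8 (.sub (.var 7) (.get 7 (.var 6)))) <|
  .seq (.ite (.lt (.var 8) (.get 8 (.var 6))) (.assign 8 (.get 8 (.var 6))) .skip) <|
  .seq (.assign 8 (.sub (.var 7) (.var 8))) <|
  .seq (.putRaw (.var 6) (.lt (.lit 0) (.var 8))) <|
  .putRaw (.add (.var 0) (.var 6)) (.var 8)

/-- The loops of the program with the assignments between them. -/
def main : Prog :=
  .seq setup.compile <| .seq (.loop fillCond.compile fillBody.compile) <|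
  .seq rootSetup.compile <| .seq (.loop searchCond.compile searchBody.compile) <|
  .seq collectSetup.compile <| .seq (.loop collectCond.compile collectBody.compile) <|
  .seq outputSetup.compile <| .loop outputCond.compile outputBody.compile

/-- The address at which the arrays start. -/
def baseExpr : Expr :=
  .add (.read (.add (.read (.lit 0)) (.lit 1))) (.add (.read (.lit 0)) (.read (.lit 0)))

/-- The whole program. -/
def program : Prog := .seq (.assign 0 baseExpr) (.seq main (.assign 0 (.lit 0)))

/-- All straight parts and loop passes stay within the machine. -/
structure Fitting (B W : ℕ) : Prop where
  setup : setup.compile.growth * W ≤ B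
  fill : passGrowth fillCond fillBody * W ≤ B
  root : rootSetup.compile.growth * W ≤ B
  search : passGrowth searchCond searchBody * W ≤ B
  collectSetup : collectSetup.compile.growth * W ≤ B
  collect : passGrowth collectCond collectBody * W ≤ B
  outputSetup : outputSetup.compile.growth * W ≤ B
  output : passGrowth outputCond outputBody * W ≤ B

/-! ### The initialization -/

section

variable {n : ℕ} (adj : Fin n → List (Fin n))

/-- The limits of the lists, one past their ends; the artificial root `n` has the list
`0, …, n - 1`. -/
def listLimit (v : ℕ) : ℕ := if v < n then listStart adj (v + 1) + 1 else listStart adj n + n + 1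

/-- The invariant of the initialization. -/
structure FillInvariant (W : ℕ) (σ : ArrayState) : Prop where
  below : σ.Below W
  var_n : σ.var 0 = n
  var_end : σ.var 1 = listStart adj n
  var_i : σ.var 2 ≤ n
  input : ∀ a < listStart adj n, σ.raw a = (init adj).mem a
  root : ∀ j < σ.var 2, σ.raw (listStart adj n + j) = j
  ptr : ∀ j < σ.var 2, σ.arr 0 j = listStart adj j
  lim : ∀ j < σ.var 2, σ.arr 1 j = listStart adj (j + 1) + 1
  low : ∀ j < σ.var 2, σ.arr 5 j = n + 2
  size : ∀ j < σ.var 2, σ.arr 6 j = 1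
  pre : ∀ v, σ.arr 2 v = 0
  sum : ∀ v, σ.arr 7 v = 0
  mx : ∀ v, σ.arr 8 v = 0

theorem forall_lt_succ_update {f : ℕ → ℕ} {g : ℕ → ℕ} {i a : ℕ} (h : ∀ j < i, f j = g j)
    (ha : a = g i) : ∀ j < i + 1, Function.update f i a j = g j := by
  intro j hj
  rw [Function.update_apply]
  split_ifs with e
  · rw [ha, e]
  · exact h j (by omega)

theorem run_fillBody (σ : ArrayState) : fillBody.run σ =
    (((((σ.setArr 0 (σ.var 2) (σ.raw (σ.var 2 + 1))).setArr 1 (σ.var 2)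
      (σ.raw (σ.var 2 + 2) + 1)).setArr 5 (σ.var 2) (σ.var 0 + 2)).setArr 6 (σ.var 2) 1).setRaw
      (σ.var 1 + σ.var 2) (σ.var 2)).setVar 2 (σ.var 2 + 1) := by
  simp [fillBody, ArrayProg.run, ArrayExpr.eval]

variable {adj} {W : ℕ}

theorem listStart_lower : n + 2 ≤ listStart adj n := by
  unfold listStart
  omega

theorem FillInvariant.step {σ : ArrayState} (h : FillInvariant adj W σ)
    (hW : listStart adj n + n + n < W) (hc : σ.var 2 < n) : FillInvariant adj W (fillBody.run σ) := by
  have hE := listStart_lower (adj := adj)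
  have h1 : σ.raw (σ.var 2 + 1) = listStart adj (σ.var 2) := by
    rw [h.input _ (by omega), init_mem_start adj (by omega)]
  have h2 : σ.raw (σ.var 2 + 2) = listStart adj (σ.var 2 + 1) := by
    rw [h.input _ (by omega), init_mem_start adj (by omega)]
  have h3 := listStart_mono adj (show σ.var 2 ≤ n by omega)
  have h4 := listStart_mono adj (show σ.var 2 + 1 ≤ n by omega)
  have hn := h.var_n
  rw [run_fillBody]
  constructor
  · refine ((((h.below.setArr ?_).setArr ?_).setArr ?_).setArr ?_).setRaw ?_ |>.setVar ?_ <;> omega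
  · simpa using hn
  · simpa using h.var_end
  · simpa using hc
  · intro a ha
    have := h.input a ha
    have hend := h.var_end
    simp only [ArrayState.setVar_raw, ArrayState.setRaw_raw, ArrayState.setArr_raw]
    -- The root's list is written from `listStart adj n` on, so the input is untouched.
    rwa [Function.update_of_ne (by omega)]
  · intro j hj
    simp only [ArrayState.setVar_var_self] at hj
    simp only [ArrayState.setVar_raw, ArrayState.setRaw_raw, ArrayState.setArr_raw, h.var_end]
    rw [Function.update_apply]
    split_ifs with e
    · omega
    · exact h.root j (by omega)
  · simpa using forall_lt_succ_update h.ptr h1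
  · simpa using forall_lt_succ_update (g := fun j => listStart adj (j + 1) + 1) h.lim (by rw [h2])
  · simpa using forall_lt_succ_update (g := fun _ => n + 2) h.low (by rw [hn])
  · simpa using forall_lt_succ_update (g := fun _ => 1) h.size rfl
  · simpa using h.pre
  · simpa using h.sum
  · simpa using h.mx

theorem FillInvariant.inRange {σ : ArrayState} (h : FillInvariant adj W σ) (hc : σ.var 2 < n) :
    fillBody.InRange (listStart adj n + n + n) σ := by
  have hE := listStart_lower (adj := adj)
  have hend := h.var_end
  simp [fillBody, ArrayProg.InRange, ArrayExpr.InRange, ArrayProg.run, ArrayExpr.eval]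
  omega

theorem achieves_fill {B : ℕ} (hB : Fitting B W) (hW : listStart adj n + n + n < W)
    {σ : ArrayState} (h : FillInvariant adj W σ) (h0 : σ.var 2 = 0) :
    Achieves B (listStart adj n + n + n) (.loop fillCond.compile fillBody.compile)
      ((n + 1) * passCost fillCond fillBody) σ
      (fun σ' => FillInvariant adj W σ' ∧ σ'.var 2 = n) := by
  have key := Achieves.loop fillCond fillBody (FillInvariant adj W) (fun σ => n - σ.var 2) hW
    hB.fill (fun σ h => ⟨h.below, by simp [fillCond, ArrayExpr.InRange]⟩) (fun σ h hc => by
      have hc : σ.var 2 < n := by simpa [fillCond, ArrayExpr.eval, h.var_n] using hc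
      refine ⟨h.inRange hc, h.step hW hc, ?_⟩
      simp only [run_fillBody, ArrayState.setVar_var_self]
      omega) h
  simp only [h0, Nat.sub_zero] at key
  intro s hs
  obtain ⟨t, s', σ', h1, h2, h3, h4, h5⟩ := key s hs
  have h5 : n ≤ σ'.var 2 := by simpa [fillCond, ArrayExpr.eval, h4.var_n] using h5
  exact ⟨t, s', σ', h1, h2, h3, h4, le_antisymm h4.var_i h5⟩

/-! ### The search -/

open DepthFirst (Entry Lists Invariant Forest Accumulated subtree cutChildren componentSize)

/-- The invariant of the search. -/
structure SearchInvariant (adj : Fin n → List (Fin n)) (W : ℕ) (R L : ℕ → ℕ) (σ : ArrayState) :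
    Prop where
  below : σ.Below W
  var_n : σ.var 0 = n
  raw : σ.raw = R
  lim : σ.arr 1 = L
  size : ∀ v ≤ n, σ.arr 6 v = 1
  sum : ∀ v, σ.arr 7 v = 0
  mx : ∀ v, σ.arr 8 v = 0
  search : Invariant n R (listStart adj) L (σ.arr 0) (σ.arr 2) (σ.arr 3) (σ.arr 4) (σ.arr 5)
    (σ.var 3) (σ.var 4)

/-- The lists as they stand in memory after the initialization. -/
structure ListsReady (adj : Fin n → List (Fin n)) (R L : ℕ → ℕ) : Prop where
  input : ∀ a < listStart adj n, R a = (init adj).mem a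
  root : ∀ j < n, R (listStart adj n + j) = j
  lim : ∀ v ≤ n, L v = listLimit adj v

theorem ListsReady.lim_le {R L : ℕ → ℕ} (h : ListsReady adj R L) {v : ℕ} (hv : v ≤ n) :
    L v ≤ listStart adj n + n + 1 := by
  rw [h.lim v hv, listLimit]
  split_ifs with hlt
  · have := listStart_mono adj (show v + 1 ≤ n from hlt)
    omega
  · exact le_rfl

/-- The limit of a list lies one past the address just after its last entry. The extra position
separates an exhausted list (`lim v - 1`) from one the search has retreated from (`lim v`); the
bound `q + 1 < lim v` in `Entry` leaves it out. -/
theorem ListsReady.entry_iff {R L : ℕ → ℕ} (h : ListsReady adj R L) (v : Fin n) (x : ℕ) :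
    Entry R (listStart adj) L v x ↔ ∃ w ∈ adj v, x = (w : Fin n) := by
  have hlim : L v = listStart adj v + (adj v).length + 1 := by
    rw [h.lim v v.2.le, listLimit, if_pos v.2, listStart_succ]
  have hmono := listStart_mono adj (show (v : ℕ) + 1 ≤ n from v.2)
  rw [listStart_succ] at hmono
  have hval : ∀ (j : ℕ) (hj : j < (adj v).length),
      R (listStart adj v + j) = ((adj v)[j] : Fin n) := by
    intro j hj
    rw [h.input _ (by omega), init_mem_entry adj v hj]
  constructor
  · rintro ⟨q, h1, h2, rfl⟩
    have hj : q - listStart adj v < (adj v).length := by omega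
    refine ⟨(adj v)[q - listStart adj v], List.getElem_mem hj, ?_⟩
    rw [← hval _ hj]
    congr 1
    omega
  · rintro ⟨w, hw, rfl⟩
    obtain ⟨j, hj, rfl⟩ := List.getElem_of_mem hw
    exact ⟨listStart adj v + j, by omega, by omega, hval j hj⟩

theorem ListsReady.entry_root_iff {R L : ℕ → ℕ} (h : ListsReady adj R L) (x : ℕ) :
    Entry R (listStart adj) L n x ↔ x < n := by
  have hlim : L n = listStart adj n + n + 1 := by
    rw [h.lim n le_rfl, listLimit, if_neg (lt_irrefl n)]
  constructor
  · rintro ⟨q, h1, h2, rfl⟩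
    have := h.root (q - listStart adj n) (by omega)
    rw [show listStart adj n + (q - listStart adj n) = q by omega] at this
    omega
  · intro hx
    exact ⟨listStart adj n + x, by omega, by omega, h.root x hx⟩

theorem ListsReady.lists {R L : ℕ → ℕ} (h : ListsReady adj R L) :
    Lists n R (listStart adj) L := by
  constructor
  · intro v hv
    rw [h.lim v hv, listLimit]
    split_ifs with hlt
    · have := listStart_mono adj (Nat.le_add_right v 1)
      omega
    · have := listStart_mono adj hv
      omega
  · intro v hv q h1 h2
    rcases hv.lt_or_eq with hlt | rfl
    · obtain ⟨w, -, hw⟩ := (h.entry_iff ⟨v, hlt⟩ (R q)).mp ⟨q, h1, h2, rfl⟩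
      rw [hw]
      exact w.2.le
    · exact ((h.entry_root_iff (R q)).mp ⟨q, h1, h2, rfl⟩).le

theorem ListsReady.represents {R L : ℕ → ℕ} (h : ListsReady adj R L) {G : SimpleGraph (Fin n)}
    (hG : G.IsAdjacencyList adj) :
    DepthFirst.Represents G (Entry R (listStart adj) L) := by
  refine ⟨fun v x => ?_, h.entry_root_iff⟩
  rw [h.entry_iff]
  refine exists_congr fun w => ?_
  rw [(hG v).2 w, and_comm]

/-- The initial measure of the search: every list counts its length plus one for the retreat, and
the list of the root contributes `n + 1`. -/
theorem ListsReady.sum_lim {R L : ℕ → ℕ} (h : ListsReady adj R L) :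
    ∑ v ∈ Finset.range (n + 1), (L v - listStart adj v) = listStart adj n + n - 1 := by
  have hsum : ∀ k ≤ n, ∑ v ∈ Finset.range k, (L v - listStart adj v) + (n + 2) =
      listStart adj k + k := by
    intro k hk
    induction k with
    | zero => simp [listStart_zero]
    | succ k ih =>
      have hmono := listStart_mono adj (Nat.le_succ k)
      have := ih (by omega)
      rw [Finset.sum_range_succ, h.lim k (by omega), listLimit, if_pos (by omega)]
      simp only [Nat.succ_eq_add_one] at hmono
      omega
  have := hsum n le_rfl
  rw [Finset.sum_range_succ, h.lim n le_rfl, listLimit, if_neg (lt_irrefl n)]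
  omega

theorem achieves_rootSetup {B : ℕ} (hB : Fitting B W) (hW : listStart adj n + n + n < W)
    (hW' : listStart adj n + n + 1 < W) {σ : ArrayState} (h : FillInvariant adj W σ) (hi : σ.var 2 = n) :
    Achieves B (listStart adj n + n + n) rootSetup.compile rootSetup.compile.cost σ
      (fun σ' => ∃ R L, ListsReady adj R L ∧ SearchInvariant adj W R L σ' ∧
        ∀ v ≤ n, σ'.arr 0 v = listStart adj v) := by
  -- The filling loop has treated the vertices below `n`; one more write at `n` completes each
  -- array.
  have hle : ∀ {f g : ℕ → ℕ} {a : ℕ}, (∀ j < σ.var 2, f j = g j) → a = g n →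
      ∀ j ≤ n, Function.update f n a j = g j := by
    intro f g a h1 h2 j hj
    rw [hi] at h1
    exact forall_lt_succ_update h1 h2 j (by omega)
  have hvn := h.var_n
  have hE := listStart_lower (adj := adj)
  have hrun : rootSetup.run σ = ((((((((σ.setArr 0 n (listStart adj n)).setArr 1 n
      (listStart adj n + n + 1)).setArr 5 n (n + 2)).setArr 6 n 1).setArr 2 n 1).setArr 3 n
      n).setArr 4 1 n).setVar 3 n).setVar 4 1 := by
    simp [rootSetup, ArrayProg.run, ArrayExpr.eval, h.var_n, h.var_end]
  refine Achieves.straight rootSetup h.below hW hB.root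
    (by simp [rootSetup, ArrayProg.InRange, ArrayExpr.InRange]) ?_
  rw [hrun]
  refine ⟨σ.raw, Function.update (σ.arr 1) n (listStart adj n + n + 1), ?_⟩
  have hready : ListsReady adj σ.raw
      (Function.update (σ.arr 1) n (listStart adj n + n + 1)) := by
    refine ⟨h.input, hi ▸ h.root, ?_⟩
    refine hle (fun j hj => ?_) (by simp [listLimit])
    rw [h.lim j hj, listLimit, if_pos (by omega)]
  have hptr : ∀ v ≤ n, Function.update (σ.arr 0) n (listStart adj n) v = listStart adj v :=
    hle h.ptr rfl
  refine ⟨hready, ⟨?_, by simpa using hvn, by simp, by simp, ?_, by simpa using h.sum,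
    by simpa using h.mx, ?_⟩, by simpa using hptr⟩
  · refine ((((((((h.below.setArr ?_).setArr ?_).setArr ?_).setArr ?_).setArr ?_).setArr
      ?_).setArr ?_).setVar ?_).setVar ?_ <;> omega
  · simpa using hle (g := fun _ => 1) h.size rfl
  · have := Invariant.start (raw := σ.raw) (ptr := Function.update (σ.arr 0) n (listStart adj n))
      (pre := Function.update (σ.arr 2) n 1) (par := Function.update (σ.arr 3) n n)
      (ord := Function.update (σ.arr 4) 1 n) (low := Function.update (σ.arr 5) n (n + 2))
      hready.lists hptr (by simp) (fun v hv => by simp [hv.ne, h.pre]) (by simp) (by simp)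
      (hle (g := fun _ => n + 2) h.low rfl)
    simpa using this

/-- The four paths through the body are a discovery, a visited entry with or without a change of the
low point, and a retreat. In each of them exactly the pointer of `cur` advances, by one. -/
theorem SearchInvariant.step {R L : ℕ → ℕ} {σ : ArrayState} (h : SearchInvariant adj W R L σ)
    (hr : ListsReady adj R L) (hW' : listStart adj n + n + 1 < W)
    (hc : σ.arr 0 (σ.var 3) < L (σ.var 3)) :
    SearchInvariant adj W R L (searchBody.run σ) ∧
      (searchBody.run σ).arr 0 =
        Function.update (σ.arr 0) (σ.var 3) (σ.arr 0 (σ.var 3) + 1) := by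
  have hcur := h.search.cur_le
  have hE := listStart_lower (adj := adj)
  have hlim := hr.lim_le hcur
  have hb1 : (σ.setVar 5 (σ.arr 0 (σ.var 3))).Below W := h.below.setVar (by omega)
  have hb2 : ((σ.setVar 5 (σ.arr 0 (σ.var 3))).setArr 0 (σ.var 3)
    (σ.arr 0 (σ.var 3) + 1)).Below W := hb1.setArr (by omega)
  by_cases hin : σ.arr 0 (σ.var 3) + 1 < L (σ.var 3)
  · have hx : R (σ.arr 0 (σ.var 3)) ≤ n :=
      hr.lists.entry_le _ hcur _ (h.search.st_le_ptr _ hcur) hin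
    by_cases hvis : σ.arr 2 (R (σ.arr 0 (σ.var 3))) = 0
    · have hrun : searchBody.run σ = ((((((((σ.setVar 5 (σ.arr 0 (σ.var 3))).setArr 0 (σ.var 3)
          (σ.arr 0 (σ.var 3) + 1)).setVar 6 (R (σ.arr 0 (σ.var 3)))).setVar 4
          (σ.var 4 + 1)).setArr 2 (R (σ.arr 0 (σ.var 3))) (σ.var 4 + 1)).setArr 3
          (R (σ.arr 0 (σ.var 3))) (σ.var 3)).setArr 4 (σ.var 4 + 1)
          (R (σ.arr 0 (σ.var 3)))).setVar 3 (R (σ.arr 0 (σ.var 3)))) := by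
        simp [searchBody, ArrayProg.run, ArrayExpr.eval, h.lim, h.raw, hin, hvis]
      have hinv := h.search.discover hr.lists hin rfl hvis
      have hcnt := hinv.cnt_le
      rw [hrun]
      refine ⟨⟨?_, by simpa using h.var_n, by simpa using h.raw, by simpa using h.lim,
        by simpa using h.size, by simpa using h.sum, by simpa using h.mx, by simpa using hinv⟩,
        by simp⟩
      refine (((((hb2.setVar ?_).setVar ?_).setArr ?_).setArr ?_).setArr ?_).setVar ?_ <;> omega
    · have hinv := h.search.skip hin hvis
      have hpre := (h.search.pre_le _ hx).trans h.search.cnt_le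
      by_cases hlow : σ.arr 2 (R (σ.arr 0 (σ.var 3))) < σ.arr 5 (σ.var 3)
      · have hrun : searchBody.run σ = ((((σ.setVar 5 (σ.arr 0 (σ.var 3))).setArr 0 (σ.var 3)
            (σ.arr 0 (σ.var 3) + 1)).setVar 6 (R (σ.arr 0 (σ.var 3)))).setArr 5 (σ.var 3)
            (σ.arr 2 (R (σ.arr 0 (σ.var 3))))) := by
          simp [searchBody, ArrayProg.run, ArrayExpr.eval, h.lim, h.raw, hin, hvis, hlow]
        rw [min_eq_right hlow.le] at hinv
        rw [hrun]
        refine ⟨⟨?_, by simpa using h.var_n, by simpa using h.raw, by simpa using h.lim,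
          by simpa using h.size, by simpa using h.sum, by simpa using h.mx, by simpa using hinv⟩,
          by simp⟩
        refine (hb2.setVar ?_).setArr ?_ <;> omega
      · have hrun : searchBody.run σ = (((σ.setVar 5 (σ.arr 0 (σ.var 3))).setArr 0 (σ.var 3)
            (σ.arr 0 (σ.var 3) + 1)).setVar 6 (R (σ.arr 0 (σ.var 3)))) := by
          simp [searchBody, ArrayProg.run, ArrayExpr.eval, h.lim, h.raw, hin, hvis, hlow]
        rw [min_eq_left (not_lt.mp hlow), Function.update_eq_self] at hinv
        rw [hrun]
        refine ⟨⟨?_, by simpa using h.var_n, by simpa using h.raw, by simpa using h.lim,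
          by simpa using h.size, by simpa using h.sum, by simpa using h.mx, by simpa using hinv⟩,
          by simp⟩
        exact hb2.setVar (by omega)
  · have hrun : searchBody.run σ = (((σ.setVar 5 (σ.arr 0 (σ.var 3))).setArr 0 (σ.var 3)
        (σ.arr 0 (σ.var 3) + 1)).setVar 3 (σ.arr 3 (σ.var 3))) := by
      simp [searchBody, ArrayProg.run, ArrayExpr.eval, h.lim, hin]
    have hinv := h.search.retreat (by omega)
    have hpar := hinv.cur_le
    rw [hrun]
    refine ⟨⟨?_, by simpa using h.var_n, by simpa using h.raw, by simpa using h.lim,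
      by simpa using h.size, by simpa using h.sum, by simpa using h.mx, by simpa using hinv⟩,
      by simp⟩
    exact hb2.setVar (by omega)

theorem SearchInvariant.inRange {R L : ℕ → ℕ} {σ : ArrayState} (h : SearchInvariant adj W R L σ)
    (hr : ListsReady adj R L) : searchBody.InRange (listStart adj n + n + n) σ := by
  have hlim := hr.lim_le h.search.cur_le
  simp only [searchBody, ArrayProg.InRange, ArrayExpr.InRange, ArrayProg.run, ArrayExpr.eval]
  simp [h.lim]
  omega

/-- Amortization: no pointer passes its limit and each pass advances one, so the total distance left
to the limits bounds the number of passes. -/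
theorem achieves_search {B : ℕ} (hB : Fitting B W) (hW : listStart adj n + n + n < W)
    (hW' : listStart adj n + n + 1 < W) {R L : ℕ → ℕ} (hr : ListsReady adj R L)
    {σ : ArrayState} (h : SearchInvariant adj W R L σ)
    (hptr : ∀ v ≤ n, σ.arr 0 v = listStart adj v) :
    Achieves B (listStart adj n + n + n) (.loop searchCond.compile searchBody.compile)
      ((listStart adj n + n) * passCost searchCond searchBody) σ
      (fun σ' => SearchInvariant adj W R L σ' ∧ L (σ'.var 3) ≤ σ'.arr 0 (σ'.var 3)) := by
  have key := Achieves.loop searchCond searchBody (SearchInvariant adj W R L)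
    (fun σ => ∑ v ∈ Finset.range (n + 1), (L v - σ.arr 0 v)) hW
    hB.search (fun σ h => ⟨h.below, by simp [searchCond, ArrayExpr.InRange]⟩) (fun σ h hc => by
      have hc : σ.arr 0 (σ.var 3) < L (σ.var 3) := by
        simpa [searchCond, ArrayExpr.eval, h.lim] using hc
      obtain ⟨h1, h2⟩ := h.step hr hW' hc
      refine ⟨h.inRange hr, h1, ?_⟩
      rw [h2]
      refine Finset.sum_lt_sum (fun v _ => ?_)
        ⟨σ.var 3, Finset.mem_range.mpr (Nat.lt_succ_of_le h.search.cur_le), ?_⟩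
      · rw [Function.update_apply]
        split_ifs with e
        · subst e; omega
        · exact le_rfl
      · rw [Function.update_self]
        omega) h
  have hsum : ∑ v ∈ Finset.range (n + 1), (L v - σ.arr 0 v) + 1 = listStart adj n + n := by
    have hE := listStart_lower (adj := adj)
    have := hr.sum_lim
    rw [Finset.sum_congr rfl fun v hv => by
      rw [hptr v (Nat.lt_succ_iff.mp (Finset.mem_range.mp hv))], this]
    omega
  rw [hsum] at key
  intro s hs
  obtain ⟨t, s', σ', h1, h2, h3, h4, h5⟩ := key s hs
  refine ⟨t, s', σ', h1, h2, h3, h4, ?_⟩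
  simpa [searchCond, ArrayExpr.eval, h4.lim] using h5

end

end ImpactProgram

end RAM

namespace RAM

namespace ImpactProgram

open DepthFirst (Entry Lists Invariant Forest Accumulated subtree cutChildren componentSize)

/-! ### The pass from the leaves to the root -/

variable {n W b B : ℕ}

/-- The invariant of the pass over the vertices in decreasing order of their numbers. -/
structure CollectInvariant (n W : ℕ) (Nb : ℕ → ℕ → Prop) (pre par ord : ℕ → ℕ) (σ : ArrayState) :
    Prop where
  below : σ.Below W
  var_n : σ.var 0 = n
  arr_pre : σ.arr 2 = pre
  arr_par : σ.arr 3 = par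
  arr_ord : σ.arr 4 = ord
  one_le : 1 ≤ σ.var 2
  le : σ.var 2 ≤ n + 1
  acc : Accumulated n Nb pre par (σ.var 2) (σ.arr 6) (σ.arr 5) (σ.arr 7) (σ.arr 8)

/-- Together with `update_max`, this matches the minimum and maximum of `Accumulated.step` with the
conditional stores of the program. -/
theorem update_min (f : ℕ → ℕ) (p a : ℕ) :
    Function.update f p (min (f p) a) = if a < f p then Function.update f p a else f := by
  split_ifs with h
  · rw [min_eq_right h.le]
  · rw [min_eq_left (not_lt.mp h), Function.update_eq_self]

theorem update_max (f : ℕ → ℕ) (p a : ℕ) :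
    Function.update f p (max (f p) a) = if f p < a then Function.update f p a else f := by
  split_ifs with h
  · rw [max_eq_right h.le]
  · rw [max_eq_left (not_lt.mp h), Function.update_eq_self]

theorem CollectInvariant.step {Nb : ℕ → ℕ → Prop} {pre par ord : ℕ → ℕ}
    (F : Forest n Nb pre par ord) {σ : ArrayState} (h : CollectInvariant n W Nb pre par ord σ)
    (hn : n + 2 < W) (hc : 1 < σ.var 2) :
    CollectInvariant n W Nb pre par ord (collectBody.run σ) ∧
      (collectBody.run σ).var 2 = σ.var 2 - 1 := by
  obtain ⟨i, hi⟩ : ∃ i, σ.var 2 = i + 1 := ⟨σ.var 2 - 1, by omega⟩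
  have hle := h.le
  obtain ⟨u, hord⟩ : ∃ u, ord (i + 1) = u := ⟨_, rfl⟩
  obtain ⟨hu, hpu⟩ := F.ord_spec (i + 1) (by omega) (by omega)
  rw [hord] at hu hpu
  -- The pass stops before number `1`, which belongs to the artificial root.
  have hun : u < n := by
    refine lt_of_le_of_ne hu fun e => ?_
    rw [e, F.pre_root] at hpu
    omega
  obtain ⟨p, hp⟩ : ∃ p, par u = p := ⟨_, rfl⟩
  have hpn : p ≤ n := hp ▸ F.par_le _ hun
  have hacc := Accumulated.step (hi ▸ h.acc) F hun hpu hp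
  -- The new size and sum count vertices of a subtree, so they are at most `n + 1` and repeated
  -- additions cannot push them past `W`.
  have hsize := hacc.size_le F hpn
  have hsum := hacc.sum_le F hpn
  rw [Function.update_self] at hsize
  rw [update_min, update_max] at hacc
  have hb := h.below
  have hlow := hb.arr 5 u
  have hsz := hb.arr 6 u
  have hvn := h.var_n
  have hpre := h.arr_pre
  have hpar := h.arr_par
  have hord' := h.arr_ord
  suffices key : (collectBody.run σ).Below W ∧ (collectBody.run σ).var 0 = n ∧
      (collectBody.run σ).arr 2 = pre ∧ (collectBody.run σ).arr 3 = par ∧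
      (collectBody.run σ).arr 4 = ord ∧ (collectBody.run σ).var 2 = i ∧
      Accumulated n Nb pre par i ((collectBody.run σ).arr 6) ((collectBody.run σ).arr 5)
        ((collectBody.run σ).arr 7) ((collectBody.run σ).arr 8) by
    obtain ⟨h1, h2, h3, h4, h5, h6, h7⟩ := key
    exact ⟨⟨h1, h2, h3, h4, h5, by omega, by omega, h6.symm ▸ h7⟩, by omega⟩
  by_cases hcut : σ.arr 5 u < pre p <;> by_cases hmx : σ.arr 8 p < σ.arr 6 u <;>
    by_cases hmin : σ.arr 5 u < σ.arr 5 p <;>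
    simp only [hcut, hmx, hmin, if_true, if_false, Function.update_self] at hacc hsum <;>
    simp [collectBody, ArrayProg.run, ArrayExpr.eval, hi, hord', hord, hpar, hp, hpre, hcut, hmx,
      hmin, hvn, hacc] <;>
    repeat' first
      | exact hb
      | refine ArrayState.Below.setVar ?_ ?_
      | refine ArrayState.Below.setArr ?_ ?_
      | omega

theorem achieves_collect {Nb : ℕ → ℕ → Prop} {pre par ord : ℕ → ℕ}
    (F : Forest n Nb pre par ord) (hB : Fitting B W) (hb : b < W) (hn : n + 2 < W)
    {σ : ArrayState} (h : CollectInvariant n W Nb pre par ord σ) :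
    Achieves B b (.loop collectCond.compile collectBody.compile)
      ((n + 2) * passCost collectCond collectBody) σ
      (fun σ' => CollectInvariant n W Nb pre par ord σ' ∧ σ'.var 2 = 1) := by
  have key := Achieves.loop collectCond collectBody (CollectInvariant n W Nb pre par ord)
    (fun σ => σ.var 2) hb hB.collect
    (fun σ h => ⟨h.below, by simp [collectCond, ArrayExpr.InRange]⟩) (fun σ h hc => by
      have hc : 1 < σ.var 2 := by
        by_contra hlt
        exact hc (if_neg hlt)
      obtain ⟨h1, h2⟩ := h.step F hn hc
      refine ⟨by simp [collectBody, ArrayProg.InRange, ArrayExpr.InRange], h1, ?_⟩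
      simp only [h2]
      omega) h
  intro s hs
  obtain ⟨t, s', σ', h1, h2, h3, h4, h5⟩ := key s hs
  have h5 : σ'.var 2 ≤ 1 := by
    by_contra hlt
    exact one_ne_zero ((if_pos (not_le.mp hlt)).symm.trans h5)
  refine ⟨t, s', σ', h1, h2.trans (Nat.mul_le_mul_right _ ?_), h3, h4, le_antisymm h5 h4.one_le⟩
  have := h.le
  omega

/-! ### The pass from the root to the leaves -/

/-- What the pass from the leaves to the root has computed. -/
structure Collected (n : ℕ) (Nb : ℕ → ℕ → Prop) (pre par size sum mx : ℕ → ℕ) : Prop where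
  size : ∀ v < n, size v = (subtree n par v).card
  sum : ∀ v < n, sum v = ∑ c ∈ cutChildren n Nb pre par v, (subtree n par c).card
  mx : ∀ v < n, mx v = (cutChildren n Nb pre par v).sup fun c => (subtree n par c).card

/-- The results for the vertex `v` stand in memory. -/
def Written {n : ℕ} (G : SimpleGraph (Fin n)) (raw : ℕ → ℕ) (v : Fin n) : Prop :=
  raw v = (if 0 < G.impact v then 1 else 0) ∧ raw (n + v) = G.impact v

/-- The invariant of the pass over the vertices in increasing order of their numbers. -/
structure OutputInvariant {n : ℕ} (G : SimpleGraph (Fin n)) (W : ℕ)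
    (pre par ord size sum mx : ℕ → ℕ) (σ : ArrayState) : Prop where
  below : σ.Below W
  var_n : σ.var 0 = n
  arr_par : σ.arr 3 = par
  arr_ord : σ.arr 4 = ord
  arr_size : σ.arr 6 = size
  arr_sum : σ.arr 7 = sum
  arr_mx : σ.arr 8 = mx
  two_le : 2 ≤ σ.var 2
  le : σ.var 2 ≤ n + 2
  component : ∀ v : Fin n, pre v < σ.var 2 → σ.arr 9 v = componentSize G v
  written : ∀ v : Fin n, pre v < σ.var 2 → Written G σ.raw v

/-- The results overwrite the beginning of the input, with the marks at `0, …, n - 1` and the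
impacts at `n, …, 2 * n - 1`. This is safe because the pass reads only variables and arrays. -/
theorem OutputInvariant.step {G : SimpleGraph (Fin n)} {Nb : ℕ → ℕ → Prop}
    {pre par ord size sum mx : ℕ → ℕ} (F : Forest n Nb pre par ord)
    (hG : DepthFirst.Represents G Nb) (hcol : Collected n Nb pre par size sum mx)
    {σ : ArrayState} (h : OutputInvariant G W pre par ord size sum mx σ)
    (hn : n + 2 < W) (hb : n + n ≤ b) (hc : σ.var 2 < n + 2) :
    outputBody.InRange b σ ∧ OutputInvariant G W pre par ord size sum mx (outputBody.run σ) ∧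
      (outputBody.run σ).var 2 = σ.var 2 + 1 := by
  have htwo := h.two_le
  obtain ⟨u, hord⟩ : ∃ u, ord (σ.var 2) = u := ⟨_, rfl⟩
  obtain ⟨hu, hpu⟩ := F.ord_spec (σ.var 2) (by omega) (by omega)
  rw [hord] at hu hpu
  have hun : u < n := by
    refine lt_of_le_of_ne hu fun e => ?_
    rw [e, F.pre_root] at hpu
    omega
  obtain ⟨p, hp⟩ : ∃ p, par u = p := ⟨_, rfl⟩
  obtain ⟨K, hK⟩ : ∃ K, componentSize G ⟨u, hun⟩ = K := ⟨_, rfl⟩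
  obtain ⟨I, hI⟩ : ∃ I, G.impact ⟨u, hun⟩ = I := ⟨_, rfl⟩
  have hroot : p = n → size u = K := by
    intro e
    rw [hcol.size u hun, ← hK]
    exact F.card_subtree_root hG (v := ⟨u, hun⟩) (hp.trans e)
  -- The parent has a smaller number, so its component size is already known, and it is adjacent to
  -- `u`.
  have hinner : p ≠ n → σ.arr 9 p = K := by
    intro e
    have hpn : p < n := lt_of_le_of_ne (hp ▸ F.par_le u hun) e
    have hlt := F.pre_par_lt u hun
    rw [hp, hpu] at hlt
    rw [h.component ⟨p, hpn⟩ hlt, ← hK]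
    exact DepthFirst.componentSize_congr
      (F.adj_par hG (v := ⟨u, hun⟩) (p := ⟨p, hpn⟩) hp).reachable
  have himp : I = K - 1 - max (K - 1 - sum u) (mx u) := by
    rw [hcol.sum u hun, hcol.mx u hun, ← hI, ← hK]
    exact F.impact_eq hG ⟨u, hun⟩
  have hKn : K ≤ n := hK ▸ DepthFirst.componentSize_le _
  have hvn := h.var_n
  have hpar := h.arr_par
  have hord' := h.arr_ord
  have hsize := h.arr_size
  have hsum := h.arr_sum
  have hmx := h.arr_mx
  have hbelow := h.below
  have hmxW : mx u < W := hmx ▸ hbelow.arr 8 u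
  have hif : (if 0 < I then 1 else 0) < W := by split_ifs <;> omega
  have hpW : p < W := by
    have := hbelow.arr 3 u
    rwa [hpar, hp] at this
  suffices key : outputBody.InRange b σ ∧ (outputBody.run σ).Below W ∧
      (outputBody.run σ).var 0 = n ∧
      (outputBody.run σ).arr 3 = par ∧ (outputBody.run σ).arr 4 = ord ∧
      (outputBody.run σ).arr 6 = size ∧ (outputBody.run σ).arr 7 = sum ∧
      (outputBody.run σ).arr 8 = mx ∧ (outputBody.run σ).var 2 = σ.var 2 + 1 ∧
      (outputBody.run σ).arr 9 = Function.update (σ.arr 9) u K ∧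
      (outputBody.run σ).raw =
        Function.update (Function.update σ.raw u (if 0 < I then 1 else 0)) (n + u) I by
    obtain ⟨h0, h1, h2, h3, h4, h5, h6, h7, h8, h9, h10⟩ := key
    -- Only `u` carries the number `σ.var 2`, so any other vertex was treated in an earlier pass.
    have hold : ∀ v : Fin n, pre v < σ.var 2 + 1 → v ≠ ⟨u, hun⟩ →
        (v : ℕ) ≠ u ∧ pre v < σ.var 2 := by
      intro v hv hne
      have hne' : (v : ℕ) ≠ u := fun e => hne (Fin.ext e)
      refine ⟨hne', lt_of_le_of_ne (Nat.lt_succ_iff.mp hv) fun e => hne' ?_⟩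
      exact F.pre_inj v.2.le hun.le (e.trans hpu.symm)
    refine ⟨h0, ⟨h1, h2, h3, h4, h5, h6, h7, by omega, by omega, ?_, ?_⟩, h8⟩
    · intro v hv
      rw [h8] at hv
      rw [h9]
      by_cases hne : v = ⟨u, hun⟩
      · subst hne
        rw [Function.update_self, hK]
      · obtain ⟨hne', hlt⟩ := hold v hv hne
        rw [Function.update_of_ne hne']
        exact h.component v hlt
    · intro v hv
      rw [h8] at hv
      rw [h10]
      have hvn := v.2
      by_cases hne : v = ⟨u, hun⟩
      · subst hne
        refine ⟨?_, ?_⟩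
        · rw [Function.update_of_ne (by simp only; omega), Function.update_self, hI]
        · rw [Function.update_self, hI]
      · obtain ⟨hne', hlt⟩ := hold v hv hne
        obtain ⟨h11, h12⟩ := h.written v hlt
        refine ⟨?_, ?_⟩
        · rw [Function.update_of_ne (by omega), Function.update_of_ne hne', h11]
        · rw [Function.update_of_ne (by omega), Function.update_of_ne (by omega), h12]
  have hval : (if p = n then size u else σ.arr 9 p) = K := by
    split_ifs with hpn
    · exact hroot hpn
    · exact hinner hpn
  by_cases hpn : p = n <;> by_cases hmax : K - 1 - sum u < mx u <;>
    simp only [hpn, if_true, if_false] at hval <;>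
    [rw [max_eq_right hmax.le] at himp; rw [max_eq_left (not_lt.mp hmax)] at himp;
      rw [max_eq_right hmax.le] at himp; rw [max_eq_left (not_lt.mp hmax)] at himp] <;>
    simp [outputBody, ArrayProg.run, ArrayProg.InRange, ArrayExpr.InRange, ArrayExpr.eval, hord',
      hord, hpar, hp, hpn, hval, hmax, hvn, hsize, hsum, hmx, ← himp] <;>
    refine ⟨by omega, ?_⟩ <;>
    repeat' first
      | exact hbelow
      | exact hif
      | refine ArrayState.Below.setVar ?_ ?_
      | refine ArrayState.Below.setArr ?_ ?_
      | refine ArrayState.Below.setRaw ?_ ?_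
      | omega

theorem achieves_output {G : SimpleGraph (Fin n)} {Nb : ℕ → ℕ → Prop}
    {pre par ord size sum mx : ℕ → ℕ} (F : Forest n Nb pre par ord)
    (hG : DepthFirst.Represents G Nb) (hcol : Collected n Nb pre par size sum mx)
    (hB : Fitting B W) (hb : b < W) (hn : n + 2 < W) (hbn : n + n ≤ b)
    {σ : ArrayState} (h : OutputInvariant G W pre par ord size sum mx σ) :
    Achieves B b (.loop outputCond.compile outputBody.compile)
      ((n + 1) * passCost outputCond outputBody) σ
      (fun σ' => σ'.var 0 = n ∧ ∀ v, Written G σ'.raw v) := by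
  have hcond : ∀ σ, OutputInvariant G W pre par ord size sum mx σ →
      outputCond.eval σ = if σ.var 2 < n + 2 then 1 else 0 := by
    intro σ h
    simp only [outputCond, ArrayExpr.eval, h.var_n]
  have key := Achieves.loop outputCond outputBody (OutputInvariant G W pre par ord size sum mx)
    (fun σ => n + 2 - σ.var 2) hb hB.output
    (fun σ h => ⟨h.below, by simp [outputCond, ArrayExpr.InRange]⟩) (fun σ h hc => by
      have hc : σ.var 2 < n + 2 := by
        by_contra hlt
        exact hc ((hcond σ h).trans (if_neg hlt))
      obtain ⟨h1, h2, h3⟩ := h.step F hG hcol hn hbn hc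
      refine ⟨h1, h2, ?_⟩
      simp only [h3]
      omega) h
  intro s hs
  obtain ⟨t, s', σ', h1, h2, h3, h4, h5⟩ := key s hs
  have h5 : n + 2 ≤ σ'.var 2 := by
    by_contra hlt
    rw [hcond σ' h4, if_pos (not_le.mp hlt)] at h5
    exact one_ne_zero h5
  refine ⟨t, s', σ', h1, h2.trans (Nat.mul_le_mul_right _ ?_), h3, h4.var_n, fun v => ?_⟩
  · have := h.two_le
    omega
  · exact h4.written v (lt_of_lt_of_le (Nat.lt_succ_of_le (F.pre_le v v.2.le)) h5)

/-! ### The whole program -/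

/-- The state after the base address of the arrays has been computed. -/
def initialState (adj : Fin n → List (Fin n)) : ArrayState where
  var _ := 0
  raw := (init adj).mem
  arr _ _ := 0

/-- A bound for the running time of the main part. -/
def mainTime (n E : ℕ) : ℕ :=
  setup.compile.cost + ((n + 1) * passCost fillCond fillBody + (rootSetup.compile.cost +
    ((E + n) * passCost searchCond searchBody + (collectSetup.compile.cost +
      ((n + 2) * passCost collectCond collectBody + (outputSetup.compile.cost +
        (n + 1) * passCost outputCond outputBody))))))

theorem achieves_main {adj : Fin n → List (Fin n)} {G : SimpleGraph (Fin n)}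
    (hG : G.IsAdjacencyList adj) (hB : Fitting B W) (hW : listStart adj n + n + n < W)
    (hW' : listStart adj n + n + 1 < W) :
    Achieves B (listStart adj n + n + n) main (mainTime n (listStart adj n)) (initialState adj)
      (fun σ' => σ'.var 0 = n ∧ ∀ v, Written G σ'.raw v) := by
  have hE := listStart_lower (adj := adj)
  have hn : n + 2 < W := by omega
  have hbelow : (initialState adj).Below W := by
    refine ⟨fun _ => ?_, fun a => ?_, fun _ _ => ?_⟩
    · exact (Nat.zero_le _).trans_lt hn
    · have := init_mem_le adj a
      simp only [initialState]
      omega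
    · exact (Nat.zero_le _).trans_lt hn
  refine Achieves.seq (Q := fun σ => FillInvariant adj W σ ∧ σ.var 2 = 0)
    (Achieves.straight setup hbelow hW hB.setup ?_ ?_) ?_
  · simp [setup, ArrayProg.InRange, ArrayExpr.InRange, ArrayProg.run, ArrayExpr.eval, initialState,
      init_mem_zero]
    omega
  · have hrun : setup.run (initialState adj) =
        ((initialState adj).setVar 0 n).setVar 1 (listStart adj n) := by
      simp [setup, ArrayProg.run, ArrayExpr.eval, initialState, init_mem_zero, init_mem_start]
    rw [hrun]
    refine ⟨⟨(hbelow.setVar (by omega)).setVar (by omega), ?_, ?_, ?_, ?_, ?_, ?_, ?_, ?_, ?_, ?_,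
      ?_, ?_⟩, ?_⟩ <;> simp [initialState]
  rintro σ ⟨h, h0⟩
  refine Achieves.seq (achieves_fill hB hW h h0) ?_
  rintro σ ⟨h, hi⟩
  refine Achieves.seq (achieves_rootSetup hB hW hW' h hi) ?_
  rintro σ ⟨R, L, hr, h, hptr⟩
  refine Achieves.seq (achieves_search hB hW hW' hr h hptr) ?_
  rintro σ ⟨h, hend⟩
  have hrep := hr.represents hG
  obtain ⟨F, hlow⟩ := h.search.forest (fun v hv => (hr.entry_root_iff v).mpr hv) hend
  have hacc := Accumulated.start F hlow h.size (fun v _ => h.sum v) (fun v _ => h.mx v)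
  refine Achieves.seq (Q := CollectInvariant n W (Entry R (listStart adj) L) (σ.arr 2) (σ.arr 3)
    (σ.arr 4)) (Achieves.straight collectSetup h.below hW hB.collectSetup
      (by simp [collectSetup, ArrayProg.InRange, ArrayExpr.InRange]) ?_) ?_
  · have hrun : collectSetup.run σ = σ.setVar 2 (n + 1) := by
      simp [collectSetup, ArrayProg.run, ArrayExpr.eval, h.var_n]
    rw [hrun]
    exact ⟨h.below.setVar (by omega), by simpa using h.var_n, rfl, rfl, rfl, by simp, by simp,
      by simpa using hacc⟩
  intro τ hτ
  refine Achieves.seq (achieves_collect F hB hW hn hτ) ?_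
  rintro ρ ⟨hρ, hone⟩
  -- The threshold has come down to `1`, below the number of every vertex, so all accumulated data
  -- are final.
  have hpos : ∀ v < n, ρ.var 2 ≤ σ.arr 2 v := by
    intro v hv
    have := F.pre_par_lt v hv
    omega
  have hcol : Collected n (Entry R (listStart adj) L) (σ.arr 2) (σ.arr 3) (ρ.arr 6) (ρ.arr 7)
      (ρ.arr 8) :=
    ⟨fun v hv => hρ.acc.size_eq F hv.le (hpos v hv), fun v hv => hρ.acc.sum_eq F hv.le (hpos v hv),
      fun v hv => hρ.acc.mx_eq F hv.le (hpos v hv)⟩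
  refine Achieves.seq (Q := OutputInvariant G W (σ.arr 2) (σ.arr 3) (σ.arr 4) (ρ.arr 6) (ρ.arr 7)
    (ρ.arr 8)) (Achieves.straight outputSetup hρ.below hW hB.outputSetup
      (by simp [outputSetup, ArrayProg.InRange, ArrayExpr.InRange]) ?_)
    fun σ' hσ' => achieves_output F hrep hcol hB hW hn (by omega) hσ'
  have hrun : outputSetup.run ρ = ρ.setVar 2 2 := by
    simp [outputSetup, ArrayProg.run, ArrayExpr.eval]
  -- Number `1` belongs to the artificial root alone, so nothing is claimed before the first output
  -- pass.
  have hnone : ∀ v : Fin n, ¬ σ.arr 2 v < 2 := by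
    intro v hv
    have h1 := hpos v v.2
    rw [hone] at h1
    exact v.2.ne (F.pre_inj v.2.le le_rfl (by rw [F.pre_root]; omega))
  rw [hrun]
  refine ⟨hρ.below.setVar (by omega), by simpa using hρ.var_n, hρ.arr_par, hρ.arr_ord, rfl, rfl,
    rfl, by simp, by simp, ?_, ?_⟩
  · intro v hv
    exact absurd (by simpa using hv) (hnone v)
  · intro v hv
    exact absurd (by simpa using hv) (hnone v)

/-! ### The constant and the main theorem -/

/-- The sum of all growth factors. -/
def totalGrowth : ℕ :=
  baseExpr.growth + setup.compile.growth + passGrowth fillCond fillBody +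
    rootSetup.compile.growth + passGrowth searchCond searchBody + collectSetup.compile.growth +
    passGrowth collectCond collectBody + outputSetup.compile.growth +
    passGrowth outputCond outputBody

/-- The sum of all costs. -/
def totalCost : ℕ :=
  baseExpr.cost + 3 + setup.compile.cost + passCost fillCond fillBody +
    rootSetup.compile.cost + passCost searchCond searchBody + collectSetup.compile.cost +
    passCost collectCond collectBody + outputSetup.compile.cost + passCost outputCond outputBody

theorem fitting {W : ℕ} (h : totalGrowth * W ≤ B) : baseExpr.growth * W ≤ B ∧ Fitting B W := by
  simp only [totalGrowth, add_mul] at h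
  refine ⟨by omega, ?_⟩
  constructor <;> omega

/-- To be used with `N = n + m + 1`: the handshake lemma gives `E + n = 2 * N`, and each fixed cost
or number of passes is at most `2 * N` times a constant. -/
theorem mainTime_le {E N : ℕ} (hn : n + 1 ≤ N) (hE : E + n ≤ 2 * N) :
    baseExpr.cost + 1 + (mainTime n E + 2) ≤ 2 * totalCost * N := by
  have h1 := Nat.mul_le_mul_right (passCost fillCond fillBody) (show n + 1 ≤ 2 * N by omega)
  have h2 := Nat.mul_le_mul_right (passCost searchCond searchBody) hE
  have h3 := Nat.mul_le_mul_right (passCost collectCond collectBody) (show n + 2 ≤ 2 * N by omega)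
  have h4 := Nat.mul_le_mul_right (passCost outputCond outputBody) (show n + 1 ≤ 2 * N by omega)
  have hN : ∀ c : ℕ, c ≤ 2 * N * c := fun c => Nat.le_mul_of_pos_left c (by omega)
  have h5 := hN (baseExpr.cost + 3)
  have h6 := hN setup.compile.cost
  have h7 := hN rootSetup.compile.cost
  have h8 := hN collectSetup.compile.cost
  have h9 := hN outputSetup.compile.cost
  have e : 2 * totalCost * N = 2 * N * totalCost := by ring
  rw [e, totalCost, mainTime]
  simp only [mul_add] at *
  omega

end ImpactProgram

end RAM

open RAM RAM.ImpactProgram in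
theorem mainTheorem1 :
    ∃ (P : RAM.Prog) (C : ℕ), ∀ (n : ℕ) (G : SimpleGraph (Fin n)) (adj : Fin n → List (Fin n)),
      G.IsAdjacencyList adj →
      ∃ (t : ℕ) (s : RAM.State),
        RAM.Exec (C * (n + G.edgeSet.ncard + 1)) P (RAM.init adj) t s ∧
        t ≤ C * (n + G.edgeSet.ncard + 1) ∧
        s.reg 0 + n ≤ C * (n + G.edgeSet.ncard + 1) ∧
        s.reg 1 + n ≤ C * (n + G.edgeSet.ncard + 1) ∧
        ∀ v : Fin n,
          (G.IsArticulationPoint v → s.mem (s.reg 0 + v) = 1 ∧ s.mem (s.reg 1 + v) = G.impact v) ∧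
          (¬ G.IsArticulationPoint v → s.mem (s.reg 0 + v) = 0) := by
  -- The three summands of the constant pay for the word size (the invariants run with `W = 4 * N`),
  -- for the time, and for the two output arrays of length `n`.
  refine ⟨program, 4 * totalGrowth + 2 * totalCost + 2, fun n G adj hG => ?_⟩
  have hE := listStart_end adj hG
  generalize G.edgeSet.ncard = m at *
  obtain ⟨N, hN⟩ : ∃ N, n + m + 1 = N := ⟨_, rfl⟩
  obtain ⟨B, hBdef⟩ : ∃ B, (4 * totalGrowth + 2 * totalCost + 2) * N = B := ⟨_, rfl⟩
  rw [hN, hBdef]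
  have hB1 : totalGrowth * (4 * N) ≤ B := by
    rw [← hBdef, add_mul, add_mul, mul_left_comm, ← mul_assoc]
    omega
  have hB2 : 2 * totalCost * N ≤ B := by
    rw [← hBdef, add_mul, add_mul]
    omega
  have hB3 : 2 * N ≤ B := by
    rw [← hBdef, add_mul, add_mul]
    omega
  obtain ⟨hbase, hfit⟩ := fitting hB1
  have hinit : (init adj).Below (4 * N) := by
    refine ⟨fun _ => ?_, fun a => ?_⟩
    · exact (show 0 < 4 * N by omega)
    · have := init_mem_le adj a
      omega
  have heval : baseExpr.eval (init adj) = listStart adj n + n + n := by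
    simp only [baseExpr, Expr.eval, init_mem_zero, init_mem_start adj le_rfl]
    omega
  have hstart := Exec.assign (B := B) 0 baseExpr (init adj) (baseExpr.fits_of_growth hinit hbase)
  rw [heval] at hstart
  -- After the base address is set, the input machine already represents the initial array state:
  -- the base lies beyond the input, so all array cells are `0`.
  have hrep : Represents (listStart adj n + n + n)
      { init adj with reg := Function.update (init adj).reg 0 (listStart adj n + n + n) }
      (initialState adj) := by
    refine ⟨by simp, fun x => ?_, fun _ _ => rfl, fun k v => ?_⟩
    · exact Function.update_of_ne (Nat.succ_ne_zero x) (listStart adj n + n + n) (init adj).reg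
    · exact init_mem_end adj (by omega)
  obtain ⟨t, s, σ, hexec, ht, hs, hvar, hwritten⟩ :=
    achieves_main hG hfit (by omega) (by omega) _ hrep
  have hreg1 : s.reg 1 = n := (hs.var 0).trans hvar
  -- Register `0` is reset from the base of the arrays to the address `0` of the marks. Register `1`
  -- holds variable `0`, which is `n`, the address of the impacts.
  have hlast := Exec.assign (B := B) 0 (Expr.lit 0) s (show 0 < B by omega)
  have htime := mainTime_le (n := n) (E := listStart adj n) (N := N) (by omega) (by omega)
  refine ⟨_, _, hstart.seq (hexec.seq hlast), ?_, ?_, ?_, ?_⟩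
  · have : (Expr.lit 0).cost = 1 := rfl
    omega
  · simp only [Function.update_self, Expr.eval]
    omega
  · simp only [Function.update_of_ne one_ne_zero, hreg1]
    omega
  · intro v
    obtain ⟨h1, h2⟩ := hwritten v
    have hv := v.2
    simp only [Function.update_self, Expr.eval, Function.update_of_ne one_ne_zero, hreg1, zero_add]
    rw [hs.raw _ (by omega), hs.raw _ (by omega), h1, h2,
      SimpleGraph.isArticulationPoint_iff_impact_pos]
    exact ⟨fun h => ⟨if_pos h, rfl⟩, fun h => if_neg h⟩
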